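/- Let $L,m,\beta>0$, let $\mathbb{T}$ be the circle of circumference $L$ with Lebesgue measure $dx$ (total mass $L$), let $\Omega=C(\mathbb{T};\mathbb{C})$ with the uniform topology and its Borel $\sigma$-algebra, and write $\langle h,\phi\rangle=\int_{\mathbb{T}}\overline{h}\,\phi\,dx$, $u_k(x)=L^{-1/2}e^{2\pi i kx/L}$ and $\lambda_k=m^2+(2\pi k/L)^2$ for $k\in\mathbb{Z}$. For $s\ge 0$ put $$\|(m^2-\Delta)^{s}\phi\|_2^2=\sum_{k\in\mathbb{Z}}\lambda_k^{2s}\,|\langle u_k,\phi\rangle|^2\in[0,\infty],\qquad N(\phi)=\|\phi\|_2^2 .$$ There is exactly one Borel probability measure $\mu_\beta$ on $\Omega$ that is Gaussian with mean zero and covariance $C=\beta^{-1}(m^2-\Delta)^{-1}$, i.e. such that for all $h\in\Omega$ $$\int_\Omega e^{i\,\mathrm{Re}\langle h,\phi\rangle}\,d\mu_\beta(\phi)=\exp\Big(-\tfrac12\sum_{k\in\mathbb{Z}}\frac{|\langle u_k,h\rangle|^2}{\beta\lambda_k}\Big).$$ Under $\mu_\beta$ the law of $N$ has a density $\rho_N\in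 C^\infty(\mathbb{R})$ with $\rho_N(s)>0$ for $s>0$ and $\rho_N(s)=0$ for $s\le 0$. Let $$K_\ell(t)=\frac1{2\pi\ell}\sum_{k=0}^{\ell-1}\sum_{j=-k}^{k}e^{ijt}\ \text{ for } |t|\le\pi,\qquad K_\ell(t)=0\ \text{ for } |t|>\pi .$$ For every $n>0$ and every integer $\ell\ge 1$, $$d\nu_{n,\beta,\ell}=\Big(\int_\Omega K_\ell(n-N)\,d\mu_\beta\Big)^{-1}K_\ell(n-N)\,d\mu_\beta$$ is a well-defined probability measure, and as $\ell\to\infty$ the measures $\nu_{n,\beta,\ell}$ converge weakly on $\Omega$ to a probability measure $\nu_{n,\beta}$. It satisfies $\nu_{n,\beta}(\{N=n\})=1$ for every $n>0$, the map $n\mapsto\nu_{n,\beta}(A)$ is measurable on $(0,\infty)$ for every Borel set $A\subset\Omega$, and $$\mu_\beta(A)=\int_0^\infty\rho_N(n)\,\nu_{n,\beta}(A)\,dn .$$ Moreover, for every $\gamma$ with $0\le\gamma<1/2$ there are $\varepsilon>0$ and $K<\infty$, depending only on $\gamma,\beta,m,L$, such that for all $n>0$ $$\int_\Omega \exp\big(\varepsilon\,\|(m^2-\Delta)^{\gamma/2}\phi\|_2^2\big)\,d\nu_{n,\beta}(\phi)\le\frac{K}{\rho_N(n)}<\infty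 .$$ -/

import Mathlib

open MeasureTheory ProbabilityTheory Filter Set
open scoped Topology ENNReal ContDiff BoundedContinuousFunction

namespace CircleField

/-- The space of continuous complex-valued functions on the circle of circumference `L`,
with the topology of uniform convergence. -/
abbrev Omega (L : ℝ) : Type := C(AddCircle L, ℂ)

/-- `Omega L` carries its Borel sigma-algebra. -/
noncomputable instance instMeasurableSpaceOmega (L : ℝ) : MeasurableSpace (Omega L) := borel _

instance instBorelSpaceOmega (L : ℝ) : BorelSpace (Omega L) := ⟨rfl⟩

noncomputable section

variable (L : ℝ) [Fact (0 < L)]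

/-- The `L²` inner product `⟨h, φ⟩ = ∫ conj (h x) φ x dx`, where `dx` has total mass `L`. -/
def inner2 (h φ : Omega L) : ℂ := ∫ x : AddCircle L, (starRingEnd ℂ) (h x) * φ x

/-- The mode `X_k(φ) = ⟨u_k, φ⟩`, with `u_k(x) = L^{-1/2} exp (2 π i k x / L)`; the functions
`u_k` are an orthonormal basis of `L²`. -/
def mode (k : ℤ) (φ : Omega L) : ℂ :=
  ∫ x : AddCircle L, (starRingEnd ℂ) (((Real.sqrt L)⁻¹ : ℂ) * fourier k x) * φ x

/-- `N(φ) = ‖φ‖₂²`. -/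
def mass (φ : Omega L) : ℝ := ∫ x : AddCircle L, ‖φ x‖ ^ 2

/-- The eigenvalue `m² + (2 π k / L)²` of `m² - Δ` on `u_k`. -/
def eigen (L m : ℝ) (k : ℤ) : ℝ := m ^ 2 + (2 * Real.pi * k / L) ^ 2

/-- The quadratic form `⟨h, C h⟩` of the covariance `C = β⁻¹ (m² - Δ)⁻¹`, in the eigenbasis of
`m² - Δ`. -/
def covForm (m β : ℝ) (h : Omega L) : ℝ := ∑' k : ℤ, ‖mode L k h‖ ^ 2 / (β * eigen L m k)

/-- `μ` is the Gaussian probability measure with mean zero and covariance `β⁻¹ (m² - Δ)⁻¹`, where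
complex `L²` is regarded as a real Hilbert space with inner product `Re ⟨h, φ⟩`: each real random
variable `Re ⟨h, φ⟩` is a centred Gaussian of variance `⟨h, C h⟩`. This is expressed by the
characteristic functional. -/
structure IsFreeField (m β : ℝ) (μ : Measure (Omega L)) : Prop where
  isProbabilityMeasure : IsProbabilityMeasure μ
  charFunctional : ∀ h : Omega L,
    ∫ φ, Complex.exp (((inner2 L h φ).re : ℂ) * Complex.I) ∂μ
      = Complex.exp (-(covForm L m β h : ℂ) / 2)

/-- The Fejér kernel `(2 π ℓ)⁻¹ ∑_{k < ℓ} ∑_{|j| ≤ k} exp (i j t)` on `[-π, π]`, extended by `0`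
to the real line. (The terms for `j` and `-j` combine to cosines.) -/
def fejer (ℓ : ℕ) (t : ℝ) : ℝ :=
  if |t| ≤ Real.pi then
    (2 * Real.pi * ℓ)⁻¹ *
      ∑ k ∈ Finset.range ℓ, ∑ j ∈ Finset.Icc (-(k : ℤ)) (k : ℤ), Real.cos (j * t)
  else 0

/-- The regularized conditional law: the normalization of `K_ℓ(n - N(φ)) dμ(φ)`. -/
def fejerLaw (μ : Measure (Omega L)) (n : ℝ) (ℓ : ℕ) : Measure (Omega L) :=
  (∫⁻ φ, ENNReal.ofReal (fejer ℓ (n - mass L φ)) ∂μ)⁻¹ •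
    μ.withDensity (fun φ => ENNReal.ofReal (fejer ℓ (n - mass L φ)))

/-- `‖(m² - Δ)^s φ‖₂²`, which is `∞` when `φ` is not in the domain of `(m² - Δ)^s`. -/
def sobolevSq (m s : ℝ) (φ : Omega L) : ℝ≥0∞ :=
  ∑' k : ℤ, ENNReal.ofReal ((eigen L m k ^ s * ‖mode L k φ‖) ^ 2)

end

end CircleField

/-! The modes `X_k` are independent centred complex Gaussians under the free field: `|X_k|²` is
exponential with rate `a_k = βλ_k/2`, the argument of `X_k` is uniform and independent of it, and `N
= ∑ |X_k|²` by Parseval. The proof treats one mode explicitly and all the others as a remainder.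

Uniqueness holds because a characteristic functional determines a finite measure. For existence, the
random Fourier series with independent Gaussian coefficients is summed over dyadic shells;
fourth-moment bounds make the expected sup norms of the shells summable, so the sum is almost surely
a continuous function. Independence is then used only in the form `IsFreeField.map_resample`:
replacing one mode by a fresh independent Gaussian preserves the measure.

Resample the zero mode in polar coordinates. With `R` the mass outside that mode, `N = t + R`, where
`t` is exponential and independent of `R`. The substitution `s = t + R` writes `μ` as the integral
over `s` of explicit measures `surfaceMeasure` on `{N = s}` (`IsFreeField.lintegral_eq`), whose
density in the old field and the new angle is bounded and jumps only at `s = R`. As `R` has no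
atoms, integrals of bounded continuous functions against these measures are continuous in `s`. The
Fejér kernels are an approximate identity, so the regularized laws converge at every level `n > 0`,
not merely almost every one, to the normalized surface measure; the normalization is the density `ρ`
of `N`.

`ρ` is positive on the positive half-line because `N` is below any positive level with positive
probability. It is smooth because `N` is an exponential variable plus an independent remainder of
the same kind: each such convolution gains a derivative, and there are infinitely many modes.
Finally, with small exponents the exponential weight of the zero mode absorbs its own exponential
moment, while the other modes contribute a convergent product exactly because `∑ λ_k^(γ-1)`
converges for `γ < 1/2`. The bound before normalization is uniform in the level, and dividing by
`ρ(n)` gives the stated estimate. -/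

namespace CircleField

/-! ### Modes, Parseval's identity and uniqueness from the characteristic functional. -/

section Fourier

variable (L : ℝ) [Fact (0 < L)]

/-- The normalized exponential `u_k`. -/
noncomputable def basis (k : ℤ) : Omega L := ((Real.sqrt L)⁻¹ : ℂ) • fourier k

lemma integrable_coe (f : Omega L) : Integrable f (volume : Measure (AddCircle L)) :=
  f.continuous.integrable_of_hasCompactSupport (HasCompactSupport.of_compactSpace _)

lemma integrable_inner2 (h φ : Omega L) :
    Integrable (fun x : AddCircle L => (starRingEnd ℂ) (h x) * φ x) :=
  integrable_coe L (star h * φ)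

lemma mode_eq_inner2 (k : ℤ) (φ : Omega L) : mode L k φ = inner2 L (basis L k) φ := rfl

lemma inner2_add_right (h φ ψ : Omega L) :
    inner2 L h (φ + ψ) = inner2 L h φ + inner2 L h ψ := by
  simp only [inner2, ContinuousMap.add_apply, mul_add]
  exact integral_add (integrable_inner2 L h φ) (integrable_inner2 L h ψ)

lemma inner2_smul_right (h : Omega L) (c : ℂ) (φ : Omega L) :
    inner2 L h (c • φ) = c * inner2 L h φ := by
  simp only [inner2, ContinuousMap.smul_apply, smul_eq_mul]
  rw [← integral_const_mul]
  congr with x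
  ring

lemma inner2_conj (h φ : Omega L) : (starRingEnd ℂ) (inner2 L h φ) = inner2 L φ h := by
  simp only [inner2]
  rw [← integral_conj]
  congr with x
  simp [mul_comm]

lemma inner2_add_left (h g φ : Omega L) :
    inner2 L (h + g) φ = inner2 L h φ + inner2 L g φ := by
  rw [← inner2_conj, inner2_add_right, map_add, inner2_conj, inner2_conj]

lemma inner2_smul_left (h : Omega L) (c : ℂ) (φ : Omega L) :
    inner2 L (c • h) φ = (starRingEnd ℂ) c * inner2 L h φ := by
  rw [← inner2_conj, inner2_smul_right, map_mul, inner2_conj]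

lemma inner2_self (φ : Omega L) : inner2 L φ φ = (mass L φ : ℂ) := by
  simp only [inner2, mass]
  rw [← integral_complex_ofReal]
  congr with x
  rw [mul_comm, Complex.mul_conj, Complex.normSq_eq_norm_sq]

lemma continuous_inner2 : Continuous fun p : Omega L × Omega L => inner2 L p.1 p.2 := by
  have hint : Continuous fun f : Omega L => ∫ x : AddCircle L, f x := by
    have h : (fun f : Omega L => ∫ x : AddCircle L, f x)
        = fun f => ∫ x, ContinuousMap.toLp (E := ℂ) 1 (volume : Measure (AddCircle L)) ℂ f x := by
      ext f
      exact integral_congr_ae (ContinuousMap.coeFn_toLp (p := 1) (𝕜 := ℂ) volume f).symm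
    rw [h]
    exact continuous_integral.comp (ContinuousMap.toLp 1 volume ℂ).continuous
  have hm : Continuous fun p : Omega L × Omega L => star p.1 * p.2 := by fun_prop
  exact hint.comp hm

lemma continuous_mode (k : ℤ) : Continuous (mode L k) :=
  (continuous_inner2 L).comp (Continuous.prodMk_right (basis L k))

lemma continuous_mass : Continuous (mass L) := by
  have h : mass L = fun φ => (inner2 L φ φ).re := by
    ext φ; rw [inner2_self]; simp
  rw [h]
  exact Complex.continuous_re.comp ((continuous_inner2 L).comp (continuous_id.prodMk continuous_id))

lemma mode_add (k : ℤ) (φ ψ : Omega L) : mode L k (φ + ψ) = mode L k φ + mode L k ψ := by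
  simp only [mode_eq_inner2, inner2_add_right]

lemma mode_smul (k : ℤ) (c : ℂ) (φ : Omega L) : mode L k (c • φ) = c * mode L k φ := by
  simp only [mode_eq_inner2, inner2_smul_right]

lemma mode_zero (k : ℤ) : mode L k 0 = 0 := by simp [mode]

lemma mode_sum {ι : Type*} (k : ℤ) (s : Finset ι) (f : ι → Omega L) :
    mode L k (∑ i ∈ s, f i) = ∑ i ∈ s, mode L k (f i) := by
  classical
  induction s using Finset.induction_on with
  | empty => simp [mode_zero]
  | insert a s ha ih => rw [Finset.sum_insert ha, Finset.sum_insert ha, mode_add, ih]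

lemma mode_eq_fourierCoeff (k : ℤ) (φ : Omega L) :
    mode L k φ = (Real.sqrt L : ℂ) * fourierCoeff φ k := by
  have hL : 0 < L := Fact.out
  have hs : ((Real.sqrt L : ℝ) : ℂ) ≠ 0 := by
    exact_mod_cast (Real.sqrt_pos.2 hL).ne'
  rw [fourierCoeff, AddCircle.integral_haarAddCircle, mode]
  have : ∀ x : AddCircle L, (starRingEnd ℂ) (((Real.sqrt L)⁻¹ : ℂ) * fourier k x) * φ x
      = ((Real.sqrt L)⁻¹ : ℂ) * (fourier (-k) x • φ x) := by
    intro x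
    simp [mul_assoc]
  simp_rw [this]
  rw [integral_const_mul, Complex.real_smul]
  have h2 : (L : ℂ) = (Real.sqrt L : ℂ) * (Real.sqrt L : ℂ) := by
    rw [← Complex.ofReal_mul, Real.mul_self_sqrt hL.le]
  push_cast
  rw [h2]
  field_simp

lemma mode_basis (k l : ℤ) : mode L k (basis L l) = if k = l then 1 else 0 := by
  have hL : 0 < L := Fact.out
  have hs : ((Real.sqrt L : ℝ) : ℂ) ≠ 0 := by
    exact_mod_cast (Real.sqrt_pos.2 hL).ne'
  rw [basis, mode_smul, mode_eq_fourierCoeff, fourierCoeff_fourier]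
  by_cases h : k = l
  · subst h; simp [hs]
  · simp [h]

/-- Parseval's identity for the modes. -/
lemma hasSum_norm_mode_sq (φ : Omega L) :
    HasSum (fun k => ‖mode L k φ‖ ^ 2) (mass L φ) := by
  have hL : 0 < L := Fact.out
  have h := hasSum_sq_fourierCoeff (ContinuousMap.toLp (E := ℂ) 2 AddCircle.haarAddCircle ℂ φ)
  simp_rw [fourierCoeff_toLp] at h
  have h1 : ∫ t : AddCircle L, ‖(ContinuousMap.toLp (E := ℂ) 2 AddCircle.haarAddCircle ℂ φ) t‖ ^ 2
      ∂AddCircle.haarAddCircle = L⁻¹ * mass L φ := by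
    rw [mass, ← smul_eq_mul, ← AddCircle.integral_haarAddCircle]
    apply integral_congr_ae
    filter_upwards [ContinuousMap.coeFn_toLp (p := 2) (𝕜 := ℂ) AddCircle.haarAddCircle φ] with x hx
    rw [hx]
  rw [h1] at h
  have h2 := h.mul_left L
  rw [mul_inv_cancel_left₀ hL.ne'] at h2
  have h3 : (fun k => ‖mode L k φ‖ ^ 2) = fun k => L * ‖fourierCoeff φ k‖ ^ 2 := by
    ext k
    rw [mode_eq_fourierCoeff, norm_mul, mul_pow, Complex.norm_real, Real.norm_eq_abs, sq_abs,
      Real.sq_sqrt hL.le]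
  rw [h3]
  exact h2

lemma eq_zero_of_mass_eq_zero {φ : Omega L} (h : mass L φ = 0) : φ = 0 := by
  have hL : 0 < L := Fact.out
  have h1 : ∀ k, mode L k φ = 0 := by
    intro k
    have := (hasSum_norm_mode_sq L φ).summable.le_tsum k (fun j _ => by positivity)
    rw [(hasSum_norm_mode_sq L φ).tsum_eq, h] at this
    have h3 : ‖mode L k φ‖ ^ 2 = 0 := le_antisymm this (by positivity)
    simpa using h3
  have h2 : fourierCoeff φ = 0 := by
    ext k
    have := h1 k
    rw [mode_eq_fourierCoeff] at this
    have hs : ((Real.sqrt L : ℝ) : ℂ) ≠ 0 := by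
      exact_mod_cast (Real.sqrt_pos.2 hL).ne'
    simpa [hs] using this
  have h3 := hasSum_fourier_series_of_summable (f := φ) (by rw [h2]; exact summable_zero)
  rw [h2] at h3
  exact h3.unique (by simp)

variable {L}

lemma continuous_charIntegrand (h : Omega L) :
    Continuous fun φ : Omega L => Complex.exp (((inner2 L h φ).re : ℂ) * Complex.I) := by
  have := (continuous_inner2 L).comp (Continuous.prodMk_right h)
  simp only [Function.comp_def] at this
  fun_prop

/-- Two finite measures with the same characteristic functional agree. -/
lemma ext_of_charFunctional {P Q : Measure (Omega L)} [IsFiniteMeasure P] [IsFiniteMeasure Q]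
    (h : ∀ h : Omega L, ∫ φ, Complex.exp (((inner2 L h φ).re : ℂ) * Complex.I) ∂P
      = ∫ φ, Complex.exp (((inner2 L h φ).re : ℂ) * Complex.I) ∂Q) : P = Q := by
  let B : Omega L →ₗ[ℝ] Omega L →ₗ[ℝ] ℝ := LinearMap.mk₂ ℝ (fun φ h => (inner2 L h φ).re)
    (fun φ ψ h => by simp [inner2_add_right])
    (fun c φ h => by
      have : c • φ = (c : ℂ) • φ := by ext x; simp
      rw [this, inner2_smul_right]; simp)
    (fun φ h g => by simp [inner2_add_left])
    (fun c φ h => by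
      have : c • h = (c : ℂ) • h := by ext x; simp
      rw [this, inner2_smul_left]; simp)
  have hB : Continuous fun p : Omega L × Omega L => B p.1 p.2 :=
    Complex.continuous_re.comp ((continuous_inner2 L).comp continuous_swap)
  refine ext_of_integral_char_eq (L := B) Real.continuous_probChar
    Real.probChar_ne_one ?_ hB ?_
  -- The pairing separates points: `φ` paired with itself is its mass.
  · intro φ hφ h0
    apply hφ
    apply eq_zero_of_mass_eq_zero L
    have : B φ φ = 0 := by rw [h0]; rfl
    change (inner2 L φ φ).re = 0 at this
    rwa [inner2_self, Complex.ofReal_re] at this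
  · intro g
    exact h g

lemma IsFreeField.unique {m β : ℝ} {P Q : Measure (Omega L)} (hP : IsFreeField L m β P)
    (hQ : IsFreeField L m β Q) : P = Q := by
  have := hP.isProbabilityMeasure
  have := hQ.isProbabilityMeasure
  exact ext_of_charFunctional fun h => by rw [hP.charFunctional, hQ.charFunctional]

end Fourier

/-! ### The rotation-invariant Gaussian on the complex plane. -/

section ComplexGaussian

/-- The centred rotation-invariant Gaussian measure on `ℂ` with density `(a / π) exp (-a |z|²)`. -/
noncomputable def cgauss (a : ℝ) : Measure ℂ :=
  volume.withDensity fun z => ENNReal.ofReal (a / Real.pi * Real.exp (-a * ‖z‖ ^ 2))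

lemma measurable_cgauss_density (a : ℝ) :
    Measurable fun z : ℂ => ENNReal.ofReal (a / Real.pi * Real.exp (-a * ‖z‖ ^ 2)) := by
  fun_prop

lemma lintegral_cgauss (a : ℝ) {F : ℂ → ℝ≥0∞} (hF : Measurable F) :
    ∫⁻ z, F z ∂(cgauss a)
      = ∫⁻ z, ENNReal.ofReal (a / Real.pi * Real.exp (-a * ‖z‖ ^ 2)) * F z := by
  rw [cgauss, lintegral_withDensity_eq_lintegral_mul _ (measurable_cgauss_density a) hF]
  rfl

lemma integral_rexp_neg_mul_sq_norm_add {b : ℝ} (hb : 0 < b) (w : ℂ) :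
    Integrable (fun z : ℂ => Real.exp (-b * ‖z‖ ^ 2 + ((starRingEnd ℂ) w * z).re)) ∧
    ∫ z : ℂ, Real.exp (-b * ‖z‖ ^ 2 + ((starRingEnd ℂ) w * z).re)
      = Real.pi / b * Real.exp (‖w‖ ^ 2 / (4 * b)) := by
  have h := GaussianFourier.integral_cexp_neg_mul_sq_norm_add (V := ℂ) (b := (b : ℂ))
    (by simpa using hb) 1 w
  have hi := GaussianFourier.integrable_cexp_neg_mul_sq_norm_add (V := ℂ) (b := (b : ℂ))
    (by simpa using hb) 1 w
  have e : ∀ z : ℂ, Complex.exp (-(b : ℂ) * ‖z‖ ^ 2 + 1 * (inner ℝ w z : ℝ))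
      = ((Real.exp (-b * ‖z‖ ^ 2 + ((starRingEnd ℂ) w * z).re) : ℝ) : ℂ) := by
    intro z
    rw [Complex.inner]
    push_cast
    ring_nf
  simp_rw [e] at h hi
  constructor
  · exact hi.re
  · rw [integral_complex_ofReal, Complex.finrank_real_complex] at h
    have : ((Real.pi : ℂ) / b) ^ ((2 : ℕ) / 2 : ℂ) = (Real.pi : ℂ) / b := by norm_num
    rw [this, one_pow, one_mul] at h
    exact_mod_cast h

/-- One formula with two uses: `b = 0` gives the Laplace transform behind the fourth-moment bounds,
`w = 0` the exponential moments of `|z|²`. Both zero gives the normalization. -/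
lemma lintegral_rexp_cgauss {a : ℝ} (ha : 0 < a) {b : ℝ} (hb : b < a) (w : ℂ) :
    ∫⁻ z, ENNReal.ofReal (Real.exp (b * ‖z‖ ^ 2 + ((starRingEnd ℂ) w * z).re)) ∂(cgauss a)
      = ENNReal.ofReal (a / (a - b) * Real.exp (‖w‖ ^ 2 / (4 * (a - b)))) := by
  have hab : 0 < a - b := sub_pos.2 hb
  rw [lintegral_cgauss a (by fun_prop)]
  obtain ⟨hi, h⟩ := integral_rexp_neg_mul_sq_norm_add hab w
  have e : ∀ z : ℂ, ENNReal.ofReal (a / Real.pi * Real.exp (-a * ‖z‖ ^ 2)) *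
      ENNReal.ofReal (Real.exp (b * ‖z‖ ^ 2 + ((starRingEnd ℂ) w * z).re))
      = ENNReal.ofReal (a / Real.pi *
        Real.exp (-(a - b) * ‖z‖ ^ 2 + ((starRingEnd ℂ) w * z).re)) := by
    intro z
    rw [← ENNReal.ofReal_mul (by positivity), mul_assoc, ← Real.exp_add]
    ring_nf
  simp_rw [e]
  rw [← ofReal_integral_eq_lintegral_ofReal (hi.const_mul _)
    (Eventually.of_forall fun z => by positivity), integral_const_mul, h]
  congr 1
  field_simp

lemma isProbabilityMeasure_cgauss {a : ℝ} (ha : 0 < a) : IsProbabilityMeasure (cgauss a) := by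
  constructor
  have h := lintegral_rexp_cgauss ha ha 0
  simpa [ha.ne'] using h

lemma integral_charFun_cgauss {a : ℝ} (ha : 0 < a) (w : ℂ) :
    ∫ z, Complex.exp ((((starRingEnd ℂ) w * z).re : ℂ) * Complex.I) ∂(cgauss a)
      = Complex.exp (-(‖w‖ ^ 2 / (4 * a) : ℝ)) := by
  rw [cgauss, integral_withDensity_eq_integral_toReal_smul (measurable_cgauss_density a)
    (Eventually.of_forall fun z => ENNReal.ofReal_lt_top)]
  have h := GaussianFourier.integral_cexp_neg_mul_sq_norm_add (V := ℂ) (b := (a : ℂ))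
    (by simpa using ha) Complex.I w
  rw [Complex.finrank_real_complex] at h
  have h2 : ((Real.pi : ℂ) / a) ^ ((2 : ℕ) / 2 : ℂ) = (Real.pi : ℂ) / a := by norm_num
  rw [h2] at h
  have e : ∀ z : ℂ, (ENNReal.ofReal (a / Real.pi * Real.exp (-a * ‖z‖ ^ 2))).toReal •
      Complex.exp ((((starRingEnd ℂ) w * z).re : ℂ) * Complex.I)
      = ((a : ℂ) / Real.pi) *
        Complex.exp (-(a : ℂ) * ‖z‖ ^ 2 + Complex.I * (inner ℝ w z : ℝ)) := by
    intro z
    rw [ENNReal.toReal_ofReal (by positivity), Complex.inner, Complex.real_smul, Complex.exp_add]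
    push_cast
    ring_nf
  simp_rw [e]
  rw [integral_const_mul, h]
  have hpi : (Real.pi : ℂ) ≠ 0 := by exact_mod_cast Real.pi_ne_zero
  have ha' : (a : ℂ) ≠ 0 := by exact_mod_cast ha.ne'
  rw [← mul_assoc]
  have : (a : ℂ) / Real.pi * (Real.pi / a) = 1 := by field_simp
  rw [this, one_mul, Complex.I_sq]
  push_cast
  ring_nf

lemma cgauss_normSq_eq (a c : ℝ) : cgauss a {z | ‖z‖ ^ 2 = c} = 0 := by
  refine withDensity_absolutelyContinuous _ _ ?_
  refine measure_mono_null (t := Metric.sphere (0 : ℂ) (Real.sqrt c)) ?_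
    (Measure.addHaar_sphere _ _ _)
  intro z hz
  rw [mem_sphere_zero_iff_norm, ← (show ‖z‖ ^ 2 = c from hz), Real.sqrt_sq (norm_nonneg z)]

lemma cgauss_normSq_le_pos {a : ℝ} (ha : 0 < a) {δ : ℝ} (hδ : 0 < δ) :
    0 < cgauss a {z | ‖z‖ ^ 2 ≤ δ} := by
  have hm : MeasurableSet {z : ℂ | ‖z‖ ^ 2 ≤ δ} := measurableSet_le (by fun_prop) (by fun_prop)
  rw [cgauss, withDensity_apply _ hm, setLIntegral_pos_iff (measurable_cgauss_density a)]
  have : Function.support (fun z : ℂ =>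
      ENNReal.ofReal (a / Real.pi * Real.exp (-a * ‖z‖ ^ 2))) = univ := by
    ext z
    simp only [Function.mem_support, ne_eq, ENNReal.ofReal_eq_zero, not_le, mem_univ, iff_true]
    positivity
  rw [this, univ_inter]
  refine lt_of_lt_of_le (Metric.measure_ball_pos volume (0 : ℂ) (Real.sqrt_pos.2 hδ))
    (measure_mono ?_)
  intro z hz
  rw [mem_ball_zero_iff] at hz
  have := (Real.lt_sqrt (norm_nonneg z)).1 hz
  exact this.le

/-- The complex number with squared modulus `s` and argument `θ`. -/
noncomputable def polarPoint (s θ : ℝ) : ℂ := (Real.sqrt s : ℂ) * Complex.exp (θ * Complex.I)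

lemma norm_polarPoint_sq {s : ℝ} (hs : 0 ≤ s) (θ : ℝ) : ‖polarPoint s θ‖ ^ 2 = s := by
  rw [polarPoint, norm_mul, Complex.norm_exp_ofReal_mul_I, mul_one, Complex.norm_real,
    Real.norm_eq_abs, sq_abs, Real.sq_sqrt hs]

lemma continuous_polarPoint : Continuous fun p : ℝ × ℝ => polarPoint p.1 p.2 := by
  unfold polarPoint
  fun_prop

/-- Under `cgauss a` the squared modulus is exponential with rate `a`, and the argument is
independent of it and uniform. -/
lemma lintegral_cgauss_polar {a : ℝ} (ha : 0 < a) {F : ℂ → ℝ≥0∞} (hF : Measurable F) :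
    ∫⁻ z, F z ∂(cgauss a) = ∫⁻ s in Ioi (0 : ℝ), ∫⁻ θ in Ioo (-Real.pi) Real.pi,
      ENNReal.ofReal (a / (2 * Real.pi) * Real.exp (-a * s)) * F (polarPoint s θ) := by
  rw [lintegral_cgauss a hF, ← Complex.lintegral_comp_polarCoord_symm, polarCoord_target,
    Measure.volume_eq_prod, ← Measure.prod_restrict]
  have hpt : ∀ p : ℝ × ℝ, 0 < p.1 → Complex.polarCoord.symm p = polarPoint (p.1 ^ 2) p.2 := by
    intro p hp
    rw [Complex.polarCoord_symm_apply, polarPoint, Real.sqrt_sq hp.le, Complex.exp_mul_I]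
    simp
  have hmeas : Measurable fun p : ℝ × ℝ => ENNReal.ofReal p.1 *
      (ENNReal.ofReal (a / Real.pi * Real.exp (-a * p.1 ^ 2)) * F (polarPoint (p.1 ^ 2) p.2)) := by
    have : Measurable fun p : ℝ × ℝ => polarPoint (p.1 ^ 2) p.2 :=
      (continuous_polarPoint.comp
        ((continuous_fst.pow 2).prodMk continuous_snd)).measurable
    have := hF.comp this
    simp only [Function.comp_def] at this
    fun_prop
  have h1 : ∫⁻ p : ℝ × ℝ, ENNReal.ofReal p.1 •
        (ENNReal.ofReal (a / Real.pi * Real.exp (-a * ‖Complex.polarCoord.symm p‖ ^ 2)) *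
          F (Complex.polarCoord.symm p))
        ∂((volume.restrict (Ioi 0)).prod (volume.restrict (Ioo (-Real.pi) Real.pi)))
      = ∫⁻ p : ℝ × ℝ, ENNReal.ofReal p.1 *
      (ENNReal.ofReal (a / Real.pi * Real.exp (-a * p.1 ^ 2)) * F (polarPoint (p.1 ^ 2) p.2))
        ∂((volume.restrict (Ioi 0)).prod (volume.restrict (Ioo (-Real.pi) Real.pi))) := by
    apply lintegral_congr_ae
    rw [Measure.prod_restrict]
    filter_upwards [ae_restrict_mem (measurableSet_Ioi.prod measurableSet_Ioo)] with p hp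
    have hp1 : 0 < p.1 := hp.1
    rw [hpt p hp1, norm_polarPoint_sq (by positivity), smul_eq_mul]
  rw [h1, lintegral_prod _ hmeas.aemeasurable]
  -- The substitution `r = √s` turns `r dr` into `ds / 2`: the constant `a / π` becomes `a / (2π)`,
  -- and the Gaussian profile in `r` becomes an exponential one in `s`.
  have himg : Real.sqrt '' Ioi 0 = Ioi 0 := by
    ext x
    simp only [mem_image, mem_Ioi]
    constructor
    · rintro ⟨y, hy, rfl⟩; exact Real.sqrt_pos.2 hy
    · intro hx; exact ⟨x ^ 2, by positivity, Real.sqrt_sq hx.le⟩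
  have hchg := lintegral_image_eq_lintegral_abs_deriv_mul (s := Ioi (0 : ℝ)) (f := Real.sqrt)
    (f' := fun s => 1 / (2 * Real.sqrt s)) measurableSet_Ioi
    (fun x hx => (Real.hasDerivAt_sqrt (ne_of_gt hx)).hasDerivWithinAt)
    (fun x hx y hy h => by
      rwa [Real.sqrt_inj (le_of_lt hx) (le_of_lt hy)] at h)
    (fun r => ∫⁻ θ in Ioo (-Real.pi) Real.pi, ENNReal.ofReal r *
      (ENNReal.ofReal (a / Real.pi * Real.exp (-a * r ^ 2)) * F (polarPoint (r ^ 2) θ)))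
  rw [himg] at hchg
  rw [hchg]
  refine setLIntegral_congr_fun measurableSet_Ioi fun s hs => ?_
  have hs0 : 0 < s := hs
  have hsq : 0 < Real.sqrt s := Real.sqrt_pos.2 hs0
  rw [← lintegral_const_mul' _ _ ENNReal.ofReal_ne_top]
  congr with θ
  rw [Real.sq_sqrt hs0.le, ← mul_assoc, ← mul_assoc, ← ENNReal.ofReal_mul (by positivity),
    ← ENNReal.ofReal_mul (by positivity), abs_of_pos (by positivity)]
  congr 2
  field_simp

end ComplexGaussian

/-! ### Sup-norm estimates for random trigonometric polynomials. -/

section Existence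

variable (L : ℝ) [Fact (0 < L)]

/-- The trigonometric polynomial with coefficients `z k`, `k ∈ s`. -/
noncomputable def trig (s : Finset ℤ) (z : ℤ → ℂ) : Omega L := ∑ k ∈ s, z k • basis L k

variable {L}

omit [Fact (0 < L)] in
lemma trig_apply (s : Finset ℤ) (z : ℤ → ℂ) (x : AddCircle L) :
    trig L s z x = ∑ k ∈ s, z k * basis L k x := by
  simp [trig, ContinuousMap.sum_apply]

omit [Fact (0 < L)] in
lemma norm_basis_apply (k : ℤ) (x : AddCircle L) : ‖basis L k x‖ = (Real.sqrt L)⁻¹ := by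
  simp [basis, abs_of_nonneg (Real.sqrt_nonneg L), Circle.norm_coe]

lemma mode_trig (s : Finset ℤ) (z : ℤ → ℂ) (k : ℤ) :
    mode L k (trig L s z) = if k ∈ s then z k else 0 := by
  simp [trig, mode_sum, mode_smul, mode_basis]

lemma basis_mul_basis (k l : ℤ) :
    basis L k * basis L l = ((Real.sqrt L)⁻¹ : ℂ) • basis L (k + l) := by
  ext x
  simp [basis, -fourier_apply, fourier_add]

/-- Squaring only doubles the degree, and the mass of the square is the fourth power of the `L⁴`
norm. An `L²` bound for the square is therefore an `L⁴` bound for the polynomial. -/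
lemma trig_mul_self {s : Finset ℤ} {M : ℕ} (hs : s ⊆ Finset.Icc (-(M : ℤ)) M) (z : ℤ → ℂ) :
    ∃ c : ℤ → ℂ, trig L s z * trig L s z = trig L (Finset.Icc (-(2 * M : ℤ)) (2 * M)) c := by
  refine ⟨fun n => ∑ p ∈ (s ×ˢ s).filter (fun p => p.1 + p.2 = n),
    z p.1 * z p.2 * ((Real.sqrt L)⁻¹ : ℂ), ?_⟩
  have hmaps : ∀ p ∈ s ×ˢ s, p.1 + p.2 ∈ Finset.Icc (-(2 * M : ℤ)) (2 * M) := by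
    intro p hp
    rw [Finset.mem_product] at hp
    have h1 := Finset.mem_Icc.1 (hs hp.1)
    have h2 := Finset.mem_Icc.1 (hs hp.2)
    rw [Finset.mem_Icc]
    omega
  rw [trig, trig, Finset.sum_mul_sum, ← Finset.sum_product',
    ← Finset.sum_fiberwise_of_maps_to hmaps]
  refine Finset.sum_congr rfl fun n _ => ?_
  rw [Finset.sum_smul]
  refine Finset.sum_congr rfl fun p hp => ?_
  rw [Finset.mem_filter] at hp
  rw [smul_mul_smul_comm, basis_mul_basis, hp.2, smul_smul]

/-- A trigonometric polynomial of degree `M` is bounded by its `L⁴` norm. -/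
lemma norm_trig_apply_pow_four_le {s : Finset ℤ} {M : ℕ} (hs : s ⊆ Finset.Icc (-(M : ℤ)) M)
    (z : ℤ → ℂ) (x : AddCircle L) :
    ‖trig L s z x‖ ^ 4 ≤ (4 * M + 1) / L * ∫ y : AddCircle L, ‖trig L s z y‖ ^ 4 := by
  have hL : 0 < L := Fact.out
  obtain ⟨c, hc⟩ := trig_mul_self (L := L) hs z
  set T := Finset.Icc (-(2 * M : ℤ)) (2 * M) with hT
  have hmass : mass L (trig L T c) = ∫ y : AddCircle L, ‖trig L s z y‖ ^ 4 := by
    rw [← hc, mass]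
    congr with y
    rw [ContinuousMap.mul_apply, norm_mul]
    ring
  have hcard : (T.card : ℝ) = 4 * M + 1 := by
    have : T.card = 4 * M + 1 := by rw [hT, Int.card_Icc]; omega
    rw [this]; push_cast; ring
  have h1 : ‖trig L T c x‖ ≤ (Real.sqrt L)⁻¹ * ∑ k ∈ T, ‖c k‖ := by
    rw [trig_apply, Finset.mul_sum]
    refine (norm_sum_le _ _).trans (Finset.sum_le_sum fun k _ => ?_)
    rw [norm_mul, norm_basis_apply, mul_comm]
  -- Cauchy–Schwarz over the `4M + 1` frequencies of the square, then Bessel's inequality.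
  have h2 : (∑ k ∈ T, ‖c k‖) ^ 2 ≤ (4 * M + 1) * mass L (trig L T c) := by
    have h3 : ∑ k ∈ T, ‖c k‖ ^ 2 ≤ mass L (trig L T c) := by
      refine le_trans (le_of_eq ?_) (sum_le_hasSum T (fun i _ => by positivity)
        (hasSum_norm_mode_sq L (trig L T c)))
      refine Finset.sum_congr rfl fun k hk => ?_
      rw [mode_trig, if_pos hk]
    rw [← hcard]
    exact sq_sum_le_card_mul_sum_sq.trans (by gcongr)
  rw [← hmass]
  calc ‖trig L s z x‖ ^ 4 = ‖trig L T c x‖ ^ 2 := by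
        rw [← hc, ContinuousMap.mul_apply, norm_mul]; ring
    _ ≤ ((Real.sqrt L)⁻¹ * ∑ k ∈ T, ‖c k‖) ^ 2 := by gcongr
    _ = L⁻¹ * (∑ k ∈ T, ‖c k‖) ^ 2 := by
        rw [mul_pow, inv_pow, Real.sq_sqrt hL.le]
    _ ≤ L⁻¹ * ((4 * M + 1) * mass L (trig L T c)) := by gcongr
    _ = _ := by ring

lemma pow_four_le_exp_add_exp {t : ℝ} (ht : 0 < t) (y : ℝ) :
    y ^ 4 ≤ 24 / t ^ 4 * (Real.exp (t * y) + Real.exp (-(t * y))) := by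
  have h := Real.pow_div_factorial_le_exp |t * y| (abs_nonneg _) 4
  have h2 : Real.exp |t * y| ≤ Real.exp (t * y) + Real.exp (-(t * y)) := by
    rcases abs_cases (t * y) with h | h <;> rw [h.1] <;> linarith [Real.exp_pos (t * y),
      Real.exp_pos (-(t * y))]
  have h3 : |t * y| ^ 4 = t ^ 4 * y ^ 4 := by
    rw [← abs_pow, mul_pow, abs_of_nonneg]
    positivity
  rw [h3] at h
  have h4 : ((4 : ℕ).factorial : ℝ) = 24 := by norm_num [Nat.factorial]
  rw [h4] at h
  have h5 := h.trans h2
  rw [div_le_iff₀ (by norm_num)] at h5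
  rw [div_mul_eq_mul_div, le_div_iff₀ (by positivity)]
  linarith

variable {a : ℤ → ℝ}

omit [Fact (0 < L)] in
lemma measurable_trig (s : Finset ℤ) : Measurable fun z : ℤ → ℂ => trig L s z := by
  apply Continuous.measurable
  unfold trig
  fun_prop

lemma lintegral_rexp_infinitePi (ha : ∀ k, 0 < a k) (s : Finset ℤ) (w : ℤ → ℂ) :
    ∫⁻ z, ENNReal.ofReal (Real.exp (∑ k ∈ s, ((starRingEnd ℂ) (w k) * z k).re))
      ∂(Measure.infinitePi fun k => cgauss (a k))
      = ENNReal.ofReal (Real.exp (∑ k ∈ s, ‖w k‖ ^ 2 / (4 * a k))) := by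
  have := fun k => isProbabilityMeasure_cgauss (ha k)
  simp_rw [Real.exp_sum]
  have hind : iIndepFun (fun (k : ℤ) (z : ℤ → ℂ) =>
      ENNReal.ofReal (Real.exp (((starRingEnd ℂ) (w k) * z k).re)))
      (Measure.infinitePi fun k => cgauss (a k)) :=
    iIndepFun_infinitePi (P := fun k => cgauss (a k))
      (X := fun k z => ENNReal.ofReal (Real.exp (((starRingEnd ℂ) (w k) * z).re)))
      (fun k => by fun_prop)
  simp_rw [ENNReal.ofReal_prod_of_nonneg fun _ _ => (Real.exp_pos _).le]
  rw [lintegral_prod_eq_prod_lintegral_of_indepFun s _ hind (fun k => by fun_prop)]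
  refine Finset.prod_congr rfl fun k _ => ?_
  have h := lintegral_rexp_cgauss (ha k) (ha k) (w k)
  have h2 : Measurable fun z : ℂ =>
    ENNReal.ofReal (Real.exp (((starRingEnd ℂ) (w k) * z).re)) := by fun_prop
  rw [← Measure.infinitePi_map_eval (fun k => cgauss (a k)) k] at h
  rw [lintegral_map (by fun_prop) (by fun_prop)] at h
  simpa [(ha k).ne'] using h

/-- The value at `x` is a complex Gaussian with second absolute moment `∑ 1/(L a_k) ≤ v`, so its
fourth moment is of order `v²`. Exponential moments in the four directions `±1`, `±i` control the
real and imaginary parts. -/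
lemma lintegral_norm_trig_pow_four_le (ha : ∀ k, 0 < a k) (s : Finset ℤ) {v : ℝ} (hv : 0 < v)
    (hs : ∑ k ∈ s, 1 / (L * a k) ≤ v) (x : AddCircle L) :
    ∫⁻ z, ENNReal.ofReal (‖trig L s z x‖ ^ 4) ∂(Measure.infinitePi fun k => cgauss (a k))
      ≤ ENNReal.ofReal (36 * v ^ 2) := by
  have hL : 0 < L := Fact.out
  set P := Measure.infinitePi fun k => cgauss (a k) with hP
  -- Chosen so that the Gaussian exponent `(t²/4) ∑ 1/(L a_k)` is at most `1`. Each exponential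
  -- moment is then at most `e < 3`.
  set t : ℝ := 2 / Real.sqrt v with ht
  have hsv : 0 < Real.sqrt v := Real.sqrt_pos.2 hv
  have ht0 : 0 < t := by positivity
  have ht2 : t ^ 2 = 4 / v := by rw [ht, div_pow, Real.sq_sqrt hv.le]; norm_num
  have ht4 : t ^ 4 = 16 / v ^ 2 := by
    rw [show t ^ 4 = (t ^ 2) ^ 2 by ring, ht2]; ring
  let E : ℂ → (ℤ → ℂ) → ℝ := fun c z =>
    ∑ k ∈ s, ((starRingEnd ℂ) (t * c * (starRingEnd ℂ) (basis L k x)) * z k).re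
  have hE : ∀ c z, E c z = t * ((starRingEnd ℂ) c * trig L s z x).re := by
    intro c z
    simp only [E, trig_apply]
    rw [Finset.mul_sum, Complex.re_sum, Finset.mul_sum]
    refine Finset.sum_congr rfl fun k _ => ?_
    rw [← Complex.re_ofReal_mul]
    congr 1
    simp only [map_mul, Complex.conj_ofReal, Complex.conj_conj]
    ring
  have hint : ∀ c : ℂ, ‖c‖ = 1 → ∫⁻ z, ENNReal.ofReal (Real.exp (E c z)) ∂P
      ≤ ENNReal.ofReal 3 := by
    intro c hc
    rw [lintegral_rexp_infinitePi ha s]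
    apply ENNReal.ofReal_le_ofReal
    have h1 : ∑ k ∈ s, ‖(t : ℂ) * c * (starRingEnd ℂ) (basis L k x)‖ ^ 2 / (4 * a k)
        = t ^ 2 / 4 * ∑ k ∈ s, 1 / (L * a k) := by
      rw [Finset.mul_sum]
      refine Finset.sum_congr rfl fun k _ => ?_
      have := ha k
      rw [norm_mul, norm_mul, hc, RCLike.norm_conj, norm_basis_apply, Complex.norm_real,
        Real.norm_eq_abs, mul_one, mul_pow, sq_abs, inv_pow, Real.sq_sqrt hL.le]
      field_simp
    rw [h1, ht2]
    have h2 : 4 / v / 4 * ∑ k ∈ s, 1 / (L * a k) ≤ 1 := by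
      calc 4 / v / 4 * ∑ k ∈ s, 1 / (L * a k) ≤ 4 / v / 4 * v := by gcongr
        _ = 1 := by field_simp
    exact (Real.exp_le_exp.2 h2).trans (by linarith [Real.exp_one_lt_d9])
  have hEm : ∀ c, Measurable fun z => ENNReal.ofReal (Real.exp (E c z)) := by
    intro c
    simp only [E]
    fun_prop
  calc ∫⁻ z, ENNReal.ofReal (‖trig L s z x‖ ^ 4) ∂P
      ≤ ∫⁻ z, ENNReal.ofReal (3 * v ^ 2) * (ENNReal.ofReal (Real.exp (E 1 z))
        + ENNReal.ofReal (Real.exp (E (-1) z)) + ENNReal.ofReal (Real.exp (E Complex.I z))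
        + ENNReal.ofReal (Real.exp (E (-Complex.I) z))) ∂P := by
        apply lintegral_mono
        intro z
        simp only
        rw [← ENNReal.ofReal_add (by positivity) (by positivity),
          ← ENNReal.ofReal_add (by positivity) (by positivity),
          ← ENNReal.ofReal_add (by positivity) (by positivity),
          ← ENNReal.ofReal_mul (by positivity)]
        apply ENNReal.ofReal_le_ofReal
        simp only [hE]
        set D := trig L s z x
        have h1 := pow_four_le_exp_add_exp ht0 D.re
        have h2 := pow_four_le_exp_add_exp ht0 D.im
        have h3 : ‖D‖ ^ 4 ≤ 2 * (D.re ^ 4 + D.im ^ 4) := by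
          rw [show ‖D‖ ^ 4 = (‖D‖ ^ 2) ^ 2 by ring, ← Complex.normSq_eq_norm_sq,
            Complex.normSq_apply]
          nlinarith [sq_nonneg (D.re ^ 2 - D.im ^ 2)]
        have h4 : (24 : ℝ) / t ^ 4 = 3 * v ^ 2 / 2 := by
          rw [ht4]; field_simp; norm_num
        rw [h4] at h1 h2
        simp only [map_one, one_mul, map_neg, Complex.neg_re, neg_mul, Complex.conj_I,
          Complex.mul_re, Complex.I_re, Complex.I_im, zero_mul, mul_neg, neg_neg, zero_sub]
        linarith
    _ ≤ ENNReal.ofReal (3 * v ^ 2) * (ENNReal.ofReal 3 + ENNReal.ofReal 3 + ENNReal.ofReal 3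
          + ENNReal.ofReal 3) := by
        have hm1 := hEm 1
        have hm2 := hEm (-1)
        have hm3 := hEm Complex.I
        have hm4 := hEm (-Complex.I)
        rw [lintegral_const_mul _ (by fun_prop), lintegral_add_left (by fun_prop),
          lintegral_add_left (by fun_prop), lintegral_add_left (by fun_prop)]
        gcongr <;> exact hint _ (by simp)
    _ = ENNReal.ofReal (36 * v ^ 2) := by
        rw [← ENNReal.ofReal_add (by positivity) (by positivity),
          ← ENNReal.ofReal_add (by positivity) (by positivity),
          ← ENNReal.ofReal_add (by positivity) (by positivity),
          ← ENNReal.ofReal_mul (by positivity)]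
        ring_nf

/-- The inequality `y ≤ δ + y⁴/δ³` reduces the sup norm to its fourth power, which the `L⁴` bound
and Fubini reduce to pointwise fourth moments. The free parameter `δ` is tuned later, shell by
shell. -/
lemma lintegral_enorm_trig_le (ha : ∀ k, 0 < a k) {s : Finset ℤ} {M : ℕ}
    (hM : s ⊆ Finset.Icc (-(M : ℤ)) M) {v : ℝ} (hv : 0 < v)
    (hs : ∑ k ∈ s, 1 / (L * a k) ≤ v) {δ : ℝ} (hδ : 0 < δ) :
    ∫⁻ z, ‖trig L s z‖ₑ ∂(Measure.infinitePi fun k => cgauss (a k))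
      ≤ ENNReal.ofReal (δ + (4 * M + 1) * (36 * v ^ 2) / δ ^ 3) := by
  have hL : 0 < L := Fact.out
  have := fun k => isProbabilityMeasure_cgauss (ha k)
  set P := Measure.infinitePi fun k => cgauss (a k) with hP
  have hjm : Measurable fun p : (ℤ → ℂ) × AddCircle L => ENNReal.ofReal (‖trig L s p.1 p.2‖ ^ 4) := by
    simp only [trig_apply]
    fun_prop
  have hpt : ∀ z, ‖trig L s z‖ₑ ≤ ENNReal.ofReal δ + ENNReal.ofReal ((4 * M + 1) / L / δ ^ 3) *
      ∫⁻ y : AddCircle L, ENNReal.ofReal (‖trig L s z y‖ ^ 4) := by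
    intro z
    have hi : Integrable (fun y : AddCircle L => ‖trig L s z y‖ ^ 4) :=
      (show Continuous fun y : AddCircle L => ‖trig L s z y‖ ^ 4 by fun_prop
        ).integrable_of_hasCompactSupport (HasCompactSupport.of_compactSpace _)
    rw [← ofReal_integral_eq_lintegral_ofReal hi (Eventually.of_forall fun y => by positivity),
      ← ENNReal.ofReal_mul (by positivity), ← ENNReal.ofReal_add hδ.le (by positivity),
      ← ofReal_norm]
    apply ENNReal.ofReal_le_ofReal
    rw [ContinuousMap.norm_le _ (by positivity)]
    intro x
    have h := norm_trig_apply_pow_four_le hM z x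
    set y := ‖trig L s z x‖
    have hy : 0 ≤ y := norm_nonneg _
    have h2 : y ≤ δ + y ^ 4 / δ ^ 3 := by
      rcases le_total y δ with h | h
      · have : 0 ≤ y ^ 4 / δ ^ 3 := by positivity
        linarith
      · have : y ≤ y ^ 4 / δ ^ 3 := by
          rw [le_div_iff₀ (by positivity)]
          calc y * δ ^ 3 ≤ y * y ^ 3 := by gcongr
            _ = y ^ 4 := by ring
        linarith
    refine h2.trans ?_
    have h3 : y ^ 4 / δ ^ 3 ≤ ((4 * M + 1) / L * ∫ y : AddCircle L, ‖trig L s z y‖ ^ 4) / δ ^ 3 := by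
      gcongr
    refine (add_le_add le_rfl h3).trans (le_of_eq ?_)
    ring
  calc ∫⁻ z, ‖trig L s z‖ₑ ∂P
      ≤ ∫⁻ z, (ENNReal.ofReal δ + ENNReal.ofReal ((4 * M + 1) / L / δ ^ 3) *
      ∫⁻ y : AddCircle L, ENNReal.ofReal (‖trig L s z y‖ ^ 4)) ∂P := lintegral_mono hpt
    _ = ENNReal.ofReal δ + ENNReal.ofReal ((4 * M + 1) / L / δ ^ 3) *
        ∫⁻ y : AddCircle L, ∫⁻ z, ENNReal.ofReal (‖trig L s z y‖ ^ 4) ∂P := by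
        rw [lintegral_add_left measurable_const, lintegral_const, measure_univ, mul_one,
          lintegral_const_mul' _ _ ENNReal.ofReal_ne_top]
        rw [lintegral_lintegral_swap hjm.aemeasurable]
    _ ≤ ENNReal.ofReal δ + ENNReal.ofReal ((4 * M + 1) / L / δ ^ 3) *
        ∫⁻ _ : AddCircle L, ENNReal.ofReal (36 * v ^ 2) := by
        gcongr with y
        exact lintegral_norm_trig_pow_four_le ha s hv hs y
    _ = ENNReal.ofReal (δ + (4 * M + 1) * (36 * v ^ 2) / δ ^ 3) := by
        rw [lintegral_const, AddCircle.measure_univ, ← ENNReal.ofReal_mul (by positivity),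
          ← ENNReal.ofReal_mul (by positivity), ← ENNReal.ofReal_add hδ.le (by positivity)]
        congr 1
        field_simp

end Existence

/-! ### Dyadic shells and uniform convergence of the random Fourier series. -/

section Existence

variable {L : ℝ} [Fact (0 < L)] {a : ℤ → ℝ}

/-- The frequencies `|k| < 2 ^ j`. -/
noncomputable def dyadicBall (j : ℕ) : Finset ℤ := Finset.Ioo (-(2 : ℤ) ^ j) (2 ^ j)

lemma dyadicBall_mono {i j : ℕ} (h : i ≤ j) : dyadicBall i ⊆ dyadicBall j := by
  have : (2 : ℤ) ^ i ≤ 2 ^ j := pow_le_pow_right₀ (by norm_num) h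
  exact Finset.Ioo_subset_Ioo (by omega) this

lemma tendsto_dyadicBall : Tendsto dyadicBall atTop atTop := by
  refine tendsto_atTop_finset_of_monotone (fun i j h => dyadicBall_mono h) fun k => ?_
  refine ⟨k.natAbs, ?_⟩
  have h : k.natAbs < 2 ^ k.natAbs := Nat.lt_two_pow_self
  have h2 : ((2 ^ k.natAbs : ℕ) : ℤ) = 2 ^ k.natAbs := by push_cast; rfl
  rw [dyadicBall, Finset.mem_Ioo]
  omega

/-- The frequencies `2 ^ j ≤ |k| < 2 ^ (j + 1)`. -/
noncomputable def dyadicShell (j : ℕ) : Finset ℤ := dyadicBall (j + 1) \ dyadicBall j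

omit [Fact (0 < L)] in
lemma sum_trig_dyadicShell (z : ℤ → ℂ) (J : ℕ) :
    trig L (dyadicBall J) z
      = trig L (dyadicBall 0) z + ∑ j ∈ Finset.range J, trig L (dyadicShell j) z := by
  induction J with
  | zero => simp
  | succ J ih =>
    rw [Finset.sum_range_succ, ← add_assoc, ← ih, add_comm (trig L _ z)]
    exact (Finset.sum_sdiff (f := fun k => z k • basis L k)
      (dyadicBall_mono (Nat.le_succ J))).symm

/-- A shell has at most `4 · 2^j` frequencies, each with rate at least `c · 4^j`. The variance it
contributes at a point is thus of order `2^(-j)`. -/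
lemma sum_dyadicShell_le {c : ℝ} (hc : 0 < c) (hg : ∀ k : ℤ, c * (k : ℝ) ^ 2 ≤ a k) (j : ℕ) :
    ∑ k ∈ dyadicShell j, 1 / (L * a k) ≤ 4 / (c * L) / 2 ^ j := by
  have hL : 0 < L := Fact.out
  have hterm : ∀ k ∈ dyadicShell j, 1 / (L * a k) ≤ 1 / (L * (c * (2 ^ j) ^ 2)) := by
    intro k hk
    have h1 : (2 : ℤ) ^ j ≤ |k| := by
      rw [dyadicShell, Finset.mem_sdiff, dyadicBall, dyadicBall, Finset.mem_Ioo,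
        Finset.mem_Ioo] at hk
      by_contra! h
      rw [abs_lt] at h
      exact hk.2 h
    have h2 : (2 : ℝ) ^ j ≤ |(k : ℝ)| := by exact_mod_cast h1
    have h3 : ((2 : ℝ) ^ j) ^ 2 ≤ (k : ℝ) ^ 2 := by
      rw [← sq_abs (k : ℝ)]; gcongr
    have h4 : c * (2 ^ j) ^ 2 ≤ a k := le_trans (by gcongr) (hg k)
    gcongr
  refine (Finset.sum_le_card_nsmul _ _ _ hterm).trans ?_
  have hcard : ((dyadicShell j).card : ℝ) ≤ 4 * 2 ^ j := by
    have h1 : (dyadicShell j).card ≤ (dyadicBall (j + 1)).card :=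
      Finset.card_le_card Finset.sdiff_subset
    have h2 : (dyadicBall (j + 1)).card ≤ 4 * 2 ^ j := by
      rw [dyadicBall, Int.card_Ioo]
      have h3 : ((2 ^ j : ℕ) : ℤ) = 2 ^ j := by push_cast; rfl
      rw [pow_succ]
      omega
    exact_mod_cast h1.trans h2
  rw [nsmul_eq_mul]
  calc ((dyadicShell j).card : ℝ) * (1 / (L * (c * (2 ^ j) ^ 2)))
      ≤ (4 * 2 ^ j) * (1 / (L * (c * (2 ^ j) ^ 2))) := by gcongr
    _ = 4 / (c * L) / 2 ^ j := by field_simp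

/-- The dyadic partial sums of the random Fourier series converge uniformly, almost surely. -/
lemma ae_summable_trig_dyadicShell (ha : ∀ k, 0 < a k) {c : ℝ} (hc : 0 < c)
    (hg : ∀ k : ℤ, c * (k : ℝ) ^ 2 ≤ a k) :
    ∀ᵐ z ∂(Measure.infinitePi fun k => cgauss (a k)),
      Summable fun j => trig L (dyadicShell j) z := by
  have hL : 0 < L := Fact.out
  have hb : ∀ j : ℕ, ∫⁻ z, ‖trig L (dyadicShell j) z‖ₑ ∂(Measure.infinitePi fun k => cgauss (a k))
      ≤ ENNReal.ofReal ((9 / 10 : ℝ) ^ j + 9 * (36 * (4 / (c * L)) ^ 2) * (500 / 729) ^ j) := by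
    intro j
    have hsub : dyadicShell j ⊆ Finset.Icc (-((2 ^ (j + 1) : ℕ) : ℤ)) (2 ^ (j + 1) : ℕ) := by
      refine Finset.sdiff_subset.trans ?_
      push_cast
      exact Finset.Ioo_subset_Icc_self
    -- With degree of order `2^j` and variance of order `2^(-j)`, the error term is of order `2^(-j)
    -- / δ³`. Any `δ = r^j` with `r < 1` and `r³ > 1/2` makes both terms summable; `r = 9/10` gives
    -- the ratio `500/729`.
    refine (lintegral_enorm_trig_le ha hsub (v := 4 / (c * L) / 2 ^ j) (by positivity)
      (sum_dyadicShell_le hc hg j) (δ := (9 / 10) ^ j) (by positivity)).trans ?_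
    apply ENNReal.ofReal_le_ofReal
    gcongr
    have h1 : (4 * ((2 ^ (j + 1) : ℕ) : ℝ) + 1) ≤ 9 * 2 ^ j := by
      push_cast
      rw [pow_succ]
      have : (1 : ℝ) ≤ 2 ^ j := one_le_pow₀ (by norm_num)
      linarith
    calc (4 * ((2 ^ (j + 1) : ℕ) : ℝ) + 1) * (36 * (4 / (c * L) / 2 ^ j) ^ 2) / ((9 / 10) ^ j) ^ 3
        ≤ (9 * 2 ^ j) * (36 * (4 / (c * L) / 2 ^ j) ^ 2) / ((9 / 10) ^ j) ^ 3 := by gcongr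
      _ = 9 * (36 * (4 / (c * L)) ^ 2) * (500 / 729) ^ j := by
        have h2 : (500 / 729 : ℝ) ^ j = 1 / (2 ^ j * ((9 / 10) ^ j) ^ 3) := by
          rw [← pow_mul, mul_comm j 3, pow_mul, ← mul_pow, ← one_div_pow]
          norm_num
        rw [h2]
        field_simp
  have hsum : Summable fun j : ℕ =>
      (9 / 10 : ℝ) ^ j + 9 * (36 * (4 / (c * L)) ^ 2) * (500 / 729) ^ j :=
    (summable_geometric_of_lt_one (by norm_num) (by norm_num)).add
      ((summable_geometric_of_lt_one (by norm_num) (by norm_num)).mul_left _)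
  have hfin : ∫⁻ z, ∑' j, ‖trig L (dyadicShell j) z‖ₑ
      ∂(Measure.infinitePi fun k => cgauss (a k)) ≠ ⊤ := by
    rw [lintegral_tsum fun j => (measurable_trig (L := L) _).enorm.aemeasurable]
    refine ne_top_of_le_ne_top ?_ (ENNReal.tsum_le_tsum hb)
    exact hsum.tsum_ofReal_ne_top
  have hm : Measurable fun z : ℤ → ℂ => ∑' j, ‖trig L (dyadicShell j) z‖ₑ :=
    Measurable.tsum fun j => (measurable_trig (L := L) _).enorm
  filter_upwards [ae_lt_top hm hfin] with z hz
  apply Summable.of_norm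
  have h := ENNReal.summable_toReal hz.ne
  simpa using h

/-- A random continuous function with independent Gaussian modes. -/
lemma exists_random_field (ha : ∀ k, 0 < a k) {c : ℝ} (hc : 0 < c)
    (hg : ∀ k : ℤ, c * (k : ℝ) ^ 2 ≤ a k) :
    ∃ Φ : (ℤ → ℂ) → Omega L, Measurable Φ ∧
      ∀ᵐ z ∂(Measure.infinitePi fun k => cgauss (a k)),
        Tendsto (fun J => trig L (dyadicBall J) z) atTop (𝓝 (Φ z)) := by
  have h : ∀ᵐ z ∂(Measure.infinitePi fun k => cgauss (a k)), ∃ φ : Omega L,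
      Tendsto (fun J => trig L (dyadicBall J) z) atTop (𝓝 φ) := by
    filter_upwards [ae_summable_trig_dyadicShell (L := L) ha hc hg] with z hz
    refine ⟨trig L (dyadicBall 0) z + ∑' j, trig L (dyadicShell j) z, ?_⟩
    rw [funext fun J => sum_trig_dyadicShell (L := L) z J]
    exact hz.hasSum.tendsto_sum_nat.const_add _
  exact measurable_limit_of_tendsto_metrizable_ae
    (fun J => (measurable_trig (dyadicBall J)).aemeasurable) h

lemma integral_charFun_infinitePi (ha : ∀ k, 0 < a k) (s : Finset ℤ) (w : ℤ → ℂ) :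
    ∫ z, Complex.exp (((∑ k ∈ s, (starRingEnd ℂ) (w k) * z k).re : ℂ) * Complex.I)
      ∂(Measure.infinitePi fun k => cgauss (a k))
      = Complex.exp (-(∑ k ∈ s, ‖w k‖ ^ 2 / (4 * a k) : ℝ)) := by
  have := fun k => isProbabilityMeasure_cgauss (ha k)
  have e : ∀ z : ℤ → ℂ, Complex.exp (((∑ k ∈ s, (starRingEnd ℂ) (w k) * z k).re : ℂ) * Complex.I)
      = ∏ k : s, Complex.exp ((((starRingEnd ℂ) (w k) * s.restrict z k).re : ℂ) * Complex.I) := by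
    intro z
    rw [Complex.re_sum, Complex.ofReal_sum, Finset.sum_mul, Complex.exp_sum,
      ← Finset.prod_coe_sort]
    rfl
  simp_rw [e]
  rw [integral_restrict_infinitePi (μ := fun k => cgauss (a k)) (s := s) (f := fun z =>
    ∏ k : s, Complex.exp ((((starRingEnd ℂ) (w k) * z k).re : ℂ) * Complex.I))
    (by
      apply Measurable.aestronglyMeasurable
      fun_prop)]
  rw [integral_fintype_prod_eq_prod (𝕜 := ℂ) (f := fun (k : s) z =>
    Complex.exp ((((starRingEnd ℂ) (w k) * z).re : ℂ) * Complex.I))]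
  simp_rw [integral_charFun_cgauss (ha _)]
  rw [← Complex.exp_sum, Finset.sum_neg_distrib, Complex.ofReal_sum,
    Finset.sum_coe_sort s fun k => ((‖w k‖ ^ 2 / (4 * a k) : ℝ) : ℂ)]

lemma inner2_trig (h : Omega L) (s : Finset ℤ) (z : ℤ → ℂ) :
    inner2 L h (trig L s z) = ∑ k ∈ s, (starRingEnd ℂ) (mode L k h) * z k := by
  rw [← inner2_conj, trig]
  have : ∀ k, (starRingEnd ℂ) (mode L k h) = inner2 L h (basis L k) := by
    intro k; rw [mode_eq_inner2, inner2_conj]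
  simp_rw [this]
  induction s using Finset.induction_on with
  | empty => simp [inner2]
  | insert k s hk ih =>
    rw [Finset.sum_insert hk, Finset.sum_insert hk, inner2_add_left, map_add, ih, inner2_smul_left,
      map_mul, Complex.conj_conj, inner2_conj, mul_comm]

end Existence

/-! ### Existence of the free field. -/

section FreeField

variable {L m β : ℝ}

lemma sq_le_eigen (k : ℤ) : m ^ 2 ≤ eigen L m k := by
  unfold eigen
  nlinarith [sq_nonneg (2 * Real.pi * k / L)]

lemma eigen_pos (hm : 0 < m) (k : ℤ) : 0 < eigen L m k :=
  lt_of_lt_of_le (by positivity) (sq_le_eigen k)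

/-- The rate of the exponential variable `|X_k|²` under the free field. -/
noncomputable def rate (L m β : ℝ) (k : ℤ) : ℝ := β * eigen L m k / 2

lemma rate_pos (hm : 0 < m) (hβ : 0 < β) (k : ℤ) : 0 < rate L m β k := by
  have := eigen_pos (L := L) hm k
  unfold rate
  positivity

lemma mul_sq_le_rate (hβ : 0 < β) (k : ℤ) :
    (β * (2 * Real.pi / L) ^ 2 / 2) * (k : ℝ) ^ 2 ≤ rate L m β k := by
  unfold rate eigen
  have : (β * (2 * Real.pi / L) ^ 2 / 2) * (k : ℝ) ^ 2
      = β * ((2 * Real.pi * k / L) ^ 2) / 2 := by ring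
  rw [this]
  have : (2 * Real.pi * k / L) ^ 2 ≤ m ^ 2 + (2 * Real.pi * k / L) ^ 2 := by nlinarith [sq_nonneg m]
  gcongr

variable [Fact (0 < L)]

lemma summable_covForm (hm : 0 < m) (hβ : 0 < β) (h : Omega L) :
    Summable fun k : ℤ => ‖mode L k h‖ ^ 2 / (β * eigen L m k) := by
  refine Summable.of_nonneg_of_le (fun k => ?_) (fun k => ?_)
    ((hasSum_norm_mode_sq L h).summable.mul_right (β * m ^ 2)⁻¹)
  · have := eigen_pos (L := L) hm k
    positivity
  · rw [← div_eq_mul_inv]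
    have := sq_le_eigen (L := L) (m := m) k
    gcongr

/-- The law of the random Fourier series with rates `βλ_k/2` works. Its truncations have explicit
characteristic functionals, with exponents `-|w|²/(4a_k) = -|w|²/(2βλ_k)`, and dominated convergence
passes to the limit. -/
lemma exists_isFreeField (hm : 0 < m) (hβ : 0 < β) : ∃ μ, IsFreeField L m β μ := by
  have hL : 0 < L := Fact.out
  have ha := rate_pos (L := L) hm hβ
  obtain ⟨Φ, hΦ, hlim⟩ := exists_random_field (L := L) ha
    (c := β * (2 * Real.pi / L) ^ 2 / 2) (by positivity) (mul_sq_le_rate hβ)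
  have := fun k => isProbabilityMeasure_cgauss (ha k)
  set P := Measure.infinitePi fun k => cgauss (rate L m β k) with hP
  refine ⟨P.map Φ, Measure.isProbabilityMeasure_map hΦ.aemeasurable, fun h => ?_⟩
  rw [integral_map hΦ.aemeasurable (continuous_charIntegrand h).aestronglyMeasurable]
  have h1 : Tendsto (fun J => ∫ z, Complex.exp (((inner2 L h (trig L (dyadicBall J) z)).re : ℂ) *
      Complex.I) ∂P) atTop
      (𝓝 (∫ z, Complex.exp (((inner2 L h (Φ z)).re : ℂ) * Complex.I) ∂P)) := by
    refine tendsto_integral_of_dominated_convergence (fun _ => 1) (fun J => ?_)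
      (integrable_const _) (fun J => ?_) ?_
    · exact ((continuous_charIntegrand h).measurable.comp
        (measurable_trig _)).aestronglyMeasurable
    · exact Eventually.of_forall fun z => by rw [Complex.norm_exp_ofReal_mul_I]
    · filter_upwards [hlim] with z hz
      exact ((continuous_charIntegrand h).tendsto _).comp hz
  refine tendsto_nhds_unique h1 ?_
  simp_rw [inner2_trig, hP, integral_charFun_infinitePi ha]
  have h2 : Tendsto (fun J => ∑ k ∈ dyadicBall J, ‖mode L k h‖ ^ 2 / (β * eigen L m k)) atTop
      (𝓝 (covForm L m β h)) :=
    (summable_covForm hm hβ h).hasSum.comp tendsto_dyadicBall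
  have h3 : ∀ J, ∑ k ∈ dyadicBall J, ‖mode L k h‖ ^ 2 / (4 * rate L m β k)
      = (∑ k ∈ dyadicBall J, ‖mode L k h‖ ^ 2 / (β * eigen L m k)) / 2 := by
    intro J
    rw [Finset.sum_div]
    refine Finset.sum_congr rfl fun k _ => ?_
    rw [rate, div_div]
    congr 1
    ring
  simp_rw [h3]
  have h4 : Continuous fun x : ℝ => Complex.exp (-((x / 2 : ℝ) : ℂ)) := by fun_prop
  have h5 := (h4.tendsto _).comp h2
  simp only [Function.comp_def] at h5
  convert h5 using 2
  push_cast
  ring_nf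

end FreeField

/-! ### Independence of the modes, expressed by resampling. -/

section Resampling

variable {L : ℝ} [Fact (0 < L)]

/-- Replace the mode `X_k` of `φ` by `w`. -/
noncomputable def resample (k : ℤ) (w : ℂ) (φ : Omega L) : Omega L :=
  φ + (w - mode L k φ) • basis L k

lemma mode_resample (j k : ℤ) (w : ℂ) (φ : Omega L) :
    mode L j (resample k w φ) = if j = k then w else mode L j φ := by
  rw [resample, mode_add, mode_smul, mode_basis]
  by_cases h : j = k
  · subst h; simp
  · simp [h]

lemma continuous_resample (k : ℤ) :
    Continuous fun p : ℂ × Omega L => resample k p.1 p.2 := by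
  have := continuous_mode L k
  unfold resample
  fun_prop

lemma mass_resample (k : ℤ) (w : ℂ) (φ : Omega L) :
    mass L (resample k w φ) = mass L φ - ‖mode L k φ‖ ^ 2 + ‖w‖ ^ 2 := by
  have h := (hasSum_norm_mode_sq L φ).update k (‖w‖ ^ 2)
  have h2 := hasSum_norm_mode_sq L (resample k w φ)
  have e : (fun j => ‖mode L j (resample k w φ)‖ ^ 2)
      = Function.update (fun j => ‖mode L j φ‖ ^ 2) k (‖w‖ ^ 2) := by
    ext j
    by_cases hj : j = k
    · subst hj; simp [mode_resample]
    · simp [mode_resample, hj]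
  rw [e] at h2
  rw [h2.unique h]
  ring

/-- The functional splits into one that ignores mode `k` of `φ` and a linear function of `w`, so the
characteristic functional of the resampled field factorizes. -/
lemma inner2_resample (h : Omega L) (k : ℤ) (w : ℂ) (φ : Omega L) :
    inner2 L h (resample k w φ)
      = inner2 L (h + (-mode L k h) • basis L k) φ + (starRingEnd ℂ) (mode L k h) * w := by
  have hb : inner2 L h (basis L k) = (starRingEnd ℂ) (mode L k h) := by
    rw [mode_eq_inner2, inner2_conj]
  rw [resample, inner2_add_right, inner2_smul_right, hb, inner2_add_left, inner2_smul_left,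
    ← mode_eq_inner2, map_neg]
  ring

lemma covForm_sub_mode {m β : ℝ} (hm : 0 < m) (hβ : 0 < β) (h : Omega L) (k : ℤ) :
    covForm L m β (h + (-mode L k h) • basis L k)
      = covForm L m β h - ‖mode L k h‖ ^ 2 / (β * eigen L m k) := by
  have h1 := (summable_covForm hm hβ h).hasSum.update k 0
  have e : Function.update (fun k => ‖mode L k h‖ ^ 2 / (β * eigen L m k)) k 0
      = fun j => ‖mode L j (h + (-mode L k h) • basis L k)‖ ^ 2 / (β * eigen L m j) := by
    ext j
    by_cases hj : j = k
    · subst hj; simp [mode_add, mode_smul, mode_basis, -neg_smul]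
    · simp [mode_add, mode_smul, mode_basis, hj, -neg_smul]
  rw [e] at h1
  rw [covForm, h1.tsum_eq, covForm]
  ring

variable {m β : ℝ} {μ : Measure (Omega L)}

/-- Resampling one mode from its own law leaves the free field invariant. -/
lemma IsFreeField.map_resample (hμ : IsFreeField L m β μ) (hm : 0 < m) (hβ : 0 < β) (k : ℤ) :
    ((cgauss (rate L m β k)).prod μ).map (fun p => resample k p.1 p.2) = μ := by
  have := hμ.isProbabilityMeasure
  have hr := rate_pos (L := L) hm hβ k
  have := isProbabilityMeasure_cgauss hr
  have hmeas : Measurable fun p : ℂ × Omega L => resample k p.1 p.2 :=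
    (continuous_resample k).measurable
  -- It suffices to compute the characteristic functional: the variance lost by deleting mode `k`
  -- from `h` is exactly what the new Gaussian restores.
  refine IsFreeField.unique (m := m) (β := β)
    ⟨Measure.isProbabilityMeasure_map hmeas.aemeasurable, fun h => ?_⟩ hμ
  rw [integral_map hmeas.aemeasurable (continuous_charIntegrand h).aestronglyMeasurable]
  have e : ∀ p : ℂ × Omega L, Complex.exp (((inner2 L h (resample k p.1 p.2)).re : ℂ) * Complex.I)
      = Complex.exp ((((starRingEnd ℂ) (mode L k h) * p.1).re : ℂ) * Complex.I) *
        Complex.exp (((inner2 L (h + (-mode L k h) • basis L k) p.2).re : ℂ) * Complex.I) := by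
    intro p
    rw [inner2_resample, ← Complex.exp_add, Complex.add_re, Complex.ofReal_add]
    ring_nf
  simp_rw [e]
  rw [integral_prod_mul (fun w => Complex.exp ((((starRingEnd ℂ) (mode L k h) * w).re : ℂ) *
    Complex.I)) (fun φ => Complex.exp (((inner2 L (h + (-mode L k h) • basis L k) φ).re : ℂ) *
    Complex.I)), integral_charFun_cgauss hr, hμ.charFunctional, covForm_sub_mode hm hβ,
    ← Complex.exp_add]
  congr 1
  have : ‖mode L k h‖ ^ 2 / (4 * rate L m β k) = ‖mode L k h‖ ^ 2 / (β * eigen L m k) / 2 := by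
    rw [rate, div_div]
    congr 1
    ring
  rw [this]
  push_cast
  ring

lemma IsFreeField.lintegral_resample (hμ : IsFreeField L m β μ) (hm : 0 < m) (hβ : 0 < β) (k : ℤ)
    {G : Omega L → ℝ≥0∞} (hG : Measurable G) :
    ∫⁻ φ, G φ ∂μ = ∫⁻ φ, ∫⁻ w, G (resample k w φ) ∂(cgauss (rate L m β k)) ∂μ := by
  have := hμ.isProbabilityMeasure
  have := isProbabilityMeasure_cgauss (rate_pos (L := L) hm hβ k)
  have hmeas : Measurable fun p : ℂ × Omega L => resample k p.1 p.2 :=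
    (continuous_resample k).measurable
  conv_lhs => rw [← hμ.map_resample hm hβ k]
  rw [lintegral_map hG hmeas]
  exact lintegral_prod_symm _ (hG.comp hmeas).aemeasurable

/-- The mass carried by the modes outside `F`. -/
noncomputable def residual (F : Finset ℤ) (φ : Omega L) : ℝ :=
  mass L φ - ∑ k ∈ F, ‖mode L k φ‖ ^ 2

lemma continuous_residual (F : Finset ℤ) : Continuous (residual (L := L) F) :=
  (continuous_mass L).sub (continuous_finsetSum _ fun k _ => (continuous_mode L k).norm.pow 2)

lemma residual_nonneg (F : Finset ℤ) (φ : Omega L) : 0 ≤ residual F φ :=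
  sub_nonneg.2 (sum_le_hasSum F (fun _ _ => by positivity) (hasSum_norm_mode_sq L φ))

lemma residual_empty (φ : Omega L) : residual ∅ φ = mass L φ := by simp [residual]

lemma residual_anti {F G : Finset ℤ} (h : F ⊆ G) (φ : Omega L) : residual G φ ≤ residual F φ :=
  sub_le_sub_left (Finset.sum_le_sum_of_subset_of_nonneg h fun _ _ _ => by positivity) _

lemma tendsto_residual (φ : Omega L) :
    Tendsto (fun F => residual F φ) atTop (𝓝 0) := by
  have := (tendsto_const_nhds (x := mass L φ)).sub (hasSum_norm_mode_sq L φ)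
  rw [sub_self] at this
  exact this

lemma residual_resample {k : ℤ} {F : Finset ℤ} (hk : k ∉ F) (w : ℂ) (φ : Omega L) :
    residual F (resample k w φ) = ‖w‖ ^ 2 + residual (insert k F) φ := by
  rw [residual, residual, mass_resample, Finset.sum_insert hk]
  have : ∑ j ∈ F, ‖mode L j (resample k w φ)‖ ^ 2 = ∑ j ∈ F, ‖mode L j φ‖ ^ 2 :=
    Finset.sum_congr rfl fun j hj => by
      rw [mode_resample, if_neg (ne_of_mem_of_not_mem hj hk)]
  rw [this]
  ring

/-- Some mode lies outside the finite set `F`. Resampling it makes the residual `|w|²` plus a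
quantity independent of `w`, and the law of `|w|²` has no atoms. -/
lemma IsFreeField.measure_residual_eq (hμ : IsFreeField L m β μ) (hm : 0 < m) (hβ : 0 < β)
    (F : Finset ℤ) (c : ℝ) : μ {φ | residual F φ = c} = 0 := by
  obtain ⟨k, hk⟩ := Infinite.exists_notMem_finset F
  have hS : MeasurableSet {φ : Omega L | residual F φ = c} :=
    (isClosed_eq (continuous_residual F) continuous_const).measurableSet
  rw [← lintegral_indicator_one hS, hμ.lintegral_resample hm hβ k
    (measurable_one.indicator hS)]
  rw [← nonpos_iff_eq_zero]
  refine (lintegral_mono (g := fun _ => 0) fun φ => ?_).trans (by simp)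
  refine le_trans ?_ (cgauss_normSq_eq (rate L m β k) (c - residual (insert k F) φ)).le
  have hT : MeasurableSet {z : ℂ | ‖z‖ ^ 2 = c - residual (insert k F) φ} :=
    (isClosed_eq (by fun_prop) continuous_const).measurableSet
  rw [← lintegral_indicator_one hT]
  refine lintegral_mono fun w => ?_
  simp only [indicator, residual_resample hk, Set.mem_ofPred_eq, eq_sub_iff_add_eq]
  exact le_rfl

lemma IsFreeField.measure_residual_le_pos_of_insert (hμ : IsFreeField L m β μ) (hm : 0 < m)
    (hβ : 0 < β) {k : ℤ} {F : Finset ℤ} (hk : k ∉ F) {s t : ℝ} (hst : s < t)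
    (h : 0 < μ {φ | residual (insert k F) φ ≤ s}) : 0 < μ {φ | residual F φ ≤ t} := by
  have := hμ.isProbabilityMeasure
  have hr := rate_pos (L := L) hm hβ k
  have := isProbabilityMeasure_cgauss hr
  have hmeas : Measurable fun p : ℂ × Omega L => resample k p.1 p.2 :=
    (continuous_resample k).measurable
  have hS : MeasurableSet {φ : Omega L | residual F φ ≤ t} :=
    (isClosed_le (continuous_residual F) continuous_const).measurableSet
  have h1 := cgauss_normSq_le_pos hr (sub_pos.2 hst)
  rw [← hμ.map_resample hm hβ k, Measure.map_apply hmeas hS]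
  refine lt_of_lt_of_le ?_ (measure_mono (s := {z : ℂ | ‖z‖ ^ 2 ≤ t - s} ×ˢ
    {φ : Omega L | residual (insert k F) φ ≤ s}) ?_)
  · rw [Measure.prod_prod]
    exact ENNReal.mul_pos h1.ne' h.ne'
  · rintro ⟨w, φ⟩ ⟨hw, hφ⟩
    have hw' : ‖w‖ ^ 2 ≤ t - s := hw
    have hφ' : residual (insert k F) φ ≤ s := hφ
    change residual F (resample k w φ) ≤ t
    rw [residual_resample hk]
    linarith

/-- Residuals tend to zero, so for some finite set of removed modes the residual is small with
positive probability. The removed modes are independent of it and small with positive probability,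
so they can be put back one at a time. -/
lemma IsFreeField.measure_mass_le_pos (hμ : IsFreeField L m β μ) (hm : 0 < m) (hβ : 0 < β)
    {t : ℝ} (ht : 0 < t) : 0 < μ {φ | mass L φ ≤ t} := by
  have := hμ.isProbabilityMeasure
  -- Each reinserted mode uses up half of the remaining gap between `s` and `t`.
  have key : ∀ F : Finset ℤ, ∀ s t : ℝ, s < t → 0 < μ {φ | residual F φ ≤ s} →
      0 < μ {φ | mass L φ ≤ t} := by
    intro F
    induction F using Finset.induction_on with
    | empty =>
      intro s t hst h
      refine h.trans_le (measure_mono fun φ hφ => ?_)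
      have hφ' : residual ∅ φ ≤ s := hφ
      rw [residual_empty] at hφ'
      exact hφ'.trans hst.le
    | insert k F hk ih =>
      intro s t hst h
      exact ih ((s + t) / 2) t (by linarith)
        (hμ.measure_residual_le_pos_of_insert hm hβ hk (by linarith) h)
  by_contra! h0
  have hzero : ∀ J : ℕ, μ {φ | residual (dyadicBall J) φ ≤ t / 2} = 0 := by
    intro J
    by_contra hne
    exact absurd (key _ _ t (by linarith) (pos_iff_ne_zero.2 hne)) (not_lt.2 h0)
  have hcov : (univ : Set (Omega L)) ⊆ ⋃ J : ℕ, {φ | residual (dyadicBall J) φ ≤ t / 2} := by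
    intro φ _
    have := ((tendsto_residual φ).comp tendsto_dyadicBall).eventually_le_const
      (show (0 : ℝ) < t / 2 by linarith)
    obtain ⟨J, hJ⟩ := this.exists
    exact mem_iUnion.2 ⟨J, hJ⟩
  have : μ univ = 0 := measure_mono_null hcov (measure_iUnion_null hzero)
  simp at this

end Resampling

/-! ### The joint density of squared modulus and argument. -/

section Polar

/-- The density of `(|z|², arg z)` under `cgauss a`. -/
noncomputable def polarWeight (a t : ℝ) : ℝ :=
  if 0 < t then a / (2 * Real.pi) * Real.exp (-a * t) else 0

lemma polarWeight_nonneg {a : ℝ} (ha : 0 < a) (t : ℝ) : 0 ≤ polarWeight a t := by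
  unfold polarWeight
  split_ifs <;> positivity

lemma polarWeight_le {a : ℝ} (ha : 0 < a) (t : ℝ) : polarWeight a t ≤ a / (2 * Real.pi) := by
  unfold polarWeight
  split_ifs with h
  · have : Real.exp (-a * t) ≤ 1 := Real.exp_le_one_iff.2 (by nlinarith)
    have h2 : 0 ≤ a / (2 * Real.pi) := by positivity
    nlinarith
  · positivity

lemma measurable_polarWeight (a : ℝ) : Measurable (polarWeight a) := by
  unfold polarWeight
  exact Measurable.ite measurableSet_Ioi (by fun_prop) measurable_const

lemma continuousAt_polarWeight (a : ℝ) {t : ℝ} (ht : t ≠ 0) : ContinuousAt (polarWeight a) t := by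
  rcases lt_or_gt_of_ne ht with h | h
  · have : polarWeight a =ᶠ[𝓝 t] fun _ => 0 := by
      filter_upwards [eventually_lt_nhds h] with x hx
      simp [polarWeight, hx.le]
    exact continuousAt_const.congr this.symm
  · have : polarWeight a =ᶠ[𝓝 t] fun t => a / (2 * Real.pi) * Real.exp (-a * t) := by
      filter_upwards [eventually_gt_nhds h] with x hx
      simp [polarWeight, hx]
    exact ContinuousAt.congr (by fun_prop) this.symm

lemma lintegral_cgauss_polarWeight {a : ℝ} (ha : 0 < a) {F : ℂ → ℝ≥0∞} (hF : Measurable F) :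
    ∫⁻ z, F z ∂(cgauss a) = ∫⁻ s, ∫⁻ θ in Ioo (-Real.pi) Real.pi,
      ENNReal.ofReal (polarWeight a s) * F (polarPoint s θ) := by
  rw [lintegral_cgauss_polar ha hF, ← lintegral_indicator measurableSet_Ioi]
  congr with s
  by_cases hs : 0 < s
  · rw [indicator_of_mem (show s ∈ Ioi (0 : ℝ) from hs)]
    simp [polarWeight, hs]
  · rw [indicator_of_notMem (show s ∉ Ioi (0 : ℝ) from hs)]
    simp [polarWeight, hs]

end Polar

/-! ### Disintegration of the free field along the mass. -/

section Disintegration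

variable {L : ℝ} [Fact (0 < L)]

/-- Replace the zero mode of `φ` so that the mass becomes `s` and the zero mode has
argument `θ`. -/
noncomputable def surfacePoint (s : ℝ) (p : Omega L × ℝ) : Omega L :=
  resample 0 (polarPoint (s - residual {0} p.1) p.2) p.1

lemma continuous_surfacePoint :
    Continuous fun q : ℝ × (Omega L × ℝ) => surfacePoint q.1 q.2 := by
  have h1 : Continuous fun q : ℝ × (Omega L × ℝ) => q.1 - residual {0} q.2.1 :=
    continuous_fst.sub ((continuous_residual {0}).comp (continuous_fst.comp continuous_snd))
  have h2 : Continuous fun q : ℝ × (Omega L × ℝ) =>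
      polarPoint (q.1 - residual {0} q.2.1) q.2.2 :=
    continuous_polarPoint.comp (h1.prodMk (continuous_snd.comp continuous_snd))
  exact (continuous_resample 0).comp (h2.prodMk (continuous_fst.comp continuous_snd))

lemma continuous_surfacePoint_right (s : ℝ) : Continuous (surfacePoint (L := L) s) :=
  continuous_surfacePoint.comp (Continuous.prodMk_right s)

lemma mass_surfacePoint {s : ℝ} {p : Omega L × ℝ} (h : residual {0} p.1 ≤ s) :
    mass L (surfacePoint s p) = s := by
  rw [surfacePoint, ← residual_empty, residual_resample (by simp),
    norm_polarPoint_sq (by linarith)]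
  simp

variable (L) in
/-- The density of `(φ, θ)` on the level set of mass `s`. -/
noncomputable def surfaceWeight (m β s : ℝ) (p : Omega L × ℝ) : ℝ :=
  polarWeight (rate L m β 0) (s - residual {0} p.1)

lemma measurable_surfaceWeight (m β : ℝ) :
    Measurable fun q : ℝ × (Omega L × ℝ) => surfaceWeight L m β q.1 q.2 := by
  have h1 : Continuous fun q : ℝ × (Omega L × ℝ) => q.1 - residual {0} q.2.1 :=
    continuous_fst.sub ((continuous_residual {0}).comp (continuous_fst.comp continuous_snd))
  exact (measurable_polarWeight _).comp h1.measurable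

lemma measurable_surfaceWeight_right (m β s : ℝ) : Measurable (surfaceWeight L m β s) :=
  (measurable_surfaceWeight m β).comp measurable_prodMk_left

lemma surfaceWeight_nonneg {m β : ℝ} (hm : 0 < m) (hβ : 0 < β) (s : ℝ) (p : Omega L × ℝ) :
    0 ≤ surfaceWeight L m β s p :=
  polarWeight_nonneg (rate_pos hm hβ 0) _

lemma surfaceWeight_eq_zero {m β s : ℝ} {p : Omega L × ℝ} (h : s ≤ residual {0} p.1) :
    surfaceWeight L m β s p = 0 := by
  simp [surfaceWeight, polarWeight, h]

/-- The reference measure for `(φ, θ)`. -/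
noncomputable def phaseMeasure (μ : Measure (Omega L)) : Measure (Omega L × ℝ) :=
  μ.prod (volume.restrict (Ioo (-Real.pi) Real.pi))

instance (μ : Measure (Omega L)) [IsFiniteMeasure μ] : IsFiniteMeasure (phaseMeasure μ) := by
  unfold phaseMeasure
  infer_instance

omit [Fact (0 < L)] in
lemma phaseMeasure_univ (μ : Measure (Omega L)) [IsProbabilityMeasure μ] :
    phaseMeasure μ univ = ENNReal.ofReal (2 * Real.pi) := by
  rw [phaseMeasure, ← univ_prod_univ, Measure.prod_prod, measure_univ, one_mul,
    Measure.restrict_apply_univ, Real.volume_Ioo]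
  ring_nf

/-- The part of `μ` on the level set of mass `s`, not normalized: its total mass is the density
of the mass at `s`. -/
noncomputable def surfaceMeasure (m β : ℝ) (μ : Measure (Omega L)) (s : ℝ) :
    Measure (Omega L) :=
  ((phaseMeasure μ).withDensity fun p => ENNReal.ofReal (surfaceWeight L m β s p)).map
    (surfacePoint s)

variable {m β : ℝ} {μ : Measure (Omega L)}

lemma lintegral_surfaceMeasure (s : ℝ) {G : Omega L → ℝ≥0∞} (hG : Measurable G) :
    ∫⁻ φ, G φ ∂(surfaceMeasure m β μ s)
      = ∫⁻ p, ENNReal.ofReal (surfaceWeight L m β s p) * G (surfacePoint s p)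
        ∂(phaseMeasure μ) := by
  have h1 := (continuous_surfacePoint_right (L := L) s).measurable
  have h2 := (measurable_surfaceWeight_right (L := L) m β s).ennreal_ofReal
  rw [surfaceMeasure, lintegral_map hG h1]
  exact lintegral_withDensity_eq_lintegral_mul _ h2 (hG.comp h1)

lemma measurable_lintegral_surfaceMeasure [IsFiniteMeasure μ] {G : Omega L → ℝ≥0∞}
    (hG : Measurable G) : Measurable fun s => ∫⁻ φ, G φ ∂(surfaceMeasure m β μ s) := by
  simp_rw [lintegral_surfaceMeasure _ hG]
  exact ((measurable_surfaceWeight (L := L) m β).ennreal_ofReal.mul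
    (hG.comp continuous_surfacePoint.measurable)).lintegral_prod_right'

lemma measurable_surfaceMeasure [IsFiniteMeasure μ] : Measurable (surfaceMeasure m β μ) := by
  refine Measure.measurable_of_measurable_coe _ fun A hA => ?_
  simp_rw [← lintegral_indicator_one hA]
  exact measurable_lintegral_surfaceMeasure (measurable_one.indicator hA)

lemma surfaceMeasure_univ_le [IsProbabilityMeasure μ] (hm : 0 < m) (hβ : 0 < β) (s : ℝ) :
    surfaceMeasure m β μ s univ ≤ ENNReal.ofReal (rate L m β 0) := by
  have hr := rate_pos (L := L) hm hβ 0
  rw [← lintegral_one, lintegral_surfaceMeasure s measurable_const]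
  calc ∫⁻ p, ENNReal.ofReal (surfaceWeight L m β s p) * 1 ∂(phaseMeasure μ)
      ≤ ∫⁻ _, ENNReal.ofReal (rate L m β 0 / (2 * Real.pi)) ∂(phaseMeasure μ) := by
        refine lintegral_mono fun p => ?_
        rw [mul_one]
        exact ENNReal.ofReal_le_ofReal (polarWeight_le hr _)
    _ = ENNReal.ofReal (rate L m β 0) := by
        rw [lintegral_const, phaseMeasure_univ, ← ENNReal.ofReal_mul (by positivity)]
        congr 1
        field_simp

lemma isFiniteMeasure_surfaceMeasure [IsProbabilityMeasure μ] (hm : 0 < m) (hβ : 0 < β) (s : ℝ) :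
    IsFiniteMeasure (surfaceMeasure m β μ s) :=
  ⟨(surfaceMeasure_univ_le hm hβ s).trans_lt ENNReal.ofReal_lt_top⟩

lemma surfaceMeasure_of_nonpos {s : ℝ} (hs : s ≤ 0) : surfaceMeasure m β μ s = 0 := by
  rw [← Measure.measure_univ_eq_zero, ← lintegral_one, lintegral_surfaceMeasure s measurable_const]
  simp_rw [surfaceWeight_eq_zero (L := L) (m := m) (β := β) (hs.trans (residual_nonneg {0} _))]
  simp

/-- Where the residual is at least `s` the weight vanishes; elsewhere the new zero mode supplies
exactly the missing mass. -/
lemma ae_mass_surfaceMeasure (s : ℝ) : ∀ᵐ φ ∂(surfaceMeasure m β μ s), mass L φ = s := by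
  have hS : MeasurableSet {φ : Omega L | mass L φ = s}ᶜ :=
    (isClosed_eq (continuous_mass L) continuous_const).measurableSet.compl
  rw [ae_iff]
  change surfaceMeasure m β μ s {φ : Omega L | mass L φ = s}ᶜ = 0
  rw [← lintegral_indicator_one hS, lintegral_surfaceMeasure s (measurable_one.indicator hS)]
  refine lintegral_eq_zero_of_ae_eq_zero (Eventually.of_forall fun p => ?_)
  rcases le_total s (residual {0} p.1) with h | h
  · simp [surfaceWeight_eq_zero h]
  · simp [mass_surfacePoint h]

/-- Disintegration of the free field along the mass. -/
lemma IsFreeField.lintegral_eq (hμ : IsFreeField L m β μ) (hm : 0 < m) (hβ : 0 < β)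
    {G : Omega L → ℝ≥0∞} (hG : Measurable G) :
    ∫⁻ φ, G φ ∂μ = ∫⁻ s, ∫⁻ φ, G φ ∂(surfaceMeasure m β μ s) := by
  have := hμ.isProbabilityMeasure
  have hr := rate_pos (L := L) hm hβ 0
  have hjoint : Measurable fun q : ℝ × (Omega L × ℝ) =>
      ENNReal.ofReal (surfaceWeight L m β q.1 q.2) * G (surfacePoint q.1 q.2) :=
    (measurable_surfaceWeight (L := L) m β).ennreal_ofReal.mul
      (hG.comp continuous_surfacePoint.measurable)
  have h1 : ∀ φ : Omega L, ∫⁻ w, G (resample 0 w φ) ∂(cgauss (rate L m β 0))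
      = ∫⁻ s, ∫⁻ θ in Ioo (-Real.pi) Real.pi,
        ENNReal.ofReal (surfaceWeight L m β s (φ, θ)) * G (surfacePoint s (φ, θ)) := by
    intro φ
    have hm : Measurable fun w => G (resample 0 w φ) :=
      hG.comp ((continuous_resample 0).comp (Continuous.prodMk_left φ)).measurable
    rw [lintegral_cgauss_polarWeight hr hm]
    -- For fixed `φ`, translation by the residual changes the variable from `|w|²` to the total
    -- mass.
    exact (lintegral_sub_right_eq_self (μ := volume) (fun s => ∫⁻ θ in Ioo (-Real.pi) Real.pi,
      ENNReal.ofReal (polarWeight (rate L m β 0) s) * G (resample 0 (polarPoint s θ) φ))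
      (residual {0} φ)).symm
  have h2 : ∀ s, ∫⁻ φ, G φ ∂(surfaceMeasure m β μ s)
      = ∫⁻ φ, (∫⁻ θ in Ioo (-Real.pi) Real.pi,
        ENNReal.ofReal (surfaceWeight L m β s (φ, θ)) * G (surfacePoint s (φ, θ))) ∂μ := by
    intro s
    rw [lintegral_surfaceMeasure s hG, phaseMeasure]
    exact lintegral_prod _ (hjoint.comp measurable_prodMk_left).aemeasurable
  rw [hμ.lintegral_resample hm hβ 0 hG]
  simp_rw [h1, h2]
  refine lintegral_lintegral_swap ?_
  have h3 : Measurable fun r : (Omega L × ℝ) × ℝ =>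
      ENNReal.ofReal (surfaceWeight L m β r.1.2 (r.1.1, r.2)) *
        G (surfacePoint r.1.2 (r.1.1, r.2)) :=
    hjoint.comp (by fun_prop : Measurable fun r : (Omega L × ℝ) × ℝ => (r.1.2, (r.1.1, r.2)))
  exact h3.lintegral_prod_right'.aemeasurable

variable (m β μ) in
/-- The measures `surfaceMeasure m β μ s` as a kernel. -/
noncomputable def surfaceKernel [IsFiniteMeasure μ] : Kernel ℝ (Omega L) :=
  ⟨surfaceMeasure m β μ, measurable_surfaceMeasure⟩

lemma IsFreeField.integral_eq (hμ : IsFreeField L m β μ) (hm : 0 < m) (hβ : 0 < β)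
    {f : Omega L → ℝ} (hf : Integrable f μ) :
    ∫ φ, f φ ∂μ = ∫ s, ∫ φ, f φ ∂(surfaceMeasure m β μ s) := by
  have := hμ.isProbabilityMeasure
  have : IsFiniteKernel (surfaceKernel m β μ) :=
    ⟨ENNReal.ofReal (rate L m β 0), ENNReal.ofReal_lt_top, surfaceMeasure_univ_le hm hβ⟩
  -- Reading `μ` as Lebesgue measure composed with a bounded kernel gives Fubini for Bochner
  -- integrals.
  have h : μ = (surfaceKernel m β μ ∘ₖ Kernel.const Unit (volume : Measure ℝ)) () := by
    ext A hA
    rw [Kernel.comp_apply' _ _ _ hA, Kernel.const_apply, ← lintegral_indicator_one hA,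
      hμ.lintegral_eq hm hβ (measurable_one.indicator hA)]
    congr with s
    rw [lintegral_indicator_one hA]
    rfl
  rw [h] at hf
  have h2 := Kernel.integral_comp hf
  rw [← h, Kernel.const_apply] at h2
  exact h2

lemma integral_surfaceMeasure [IsFiniteMeasure μ] (hm : 0 < m) (hβ : 0 < β) (s : ℝ)
    (f : Omega L →ᵇ ℝ) :
    ∫ φ, f φ ∂(surfaceMeasure m β μ s)
      = ∫ p, surfaceWeight L m β s p * f (surfacePoint s p) ∂(phaseMeasure μ) := by
  have h1 := (continuous_surfacePoint_right (L := L) s).measurable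
  have h2 := (measurable_surfaceWeight_right (L := L) m β s).ennreal_ofReal
  rw [surfaceMeasure, integral_map h1.aemeasurable f.continuous.aestronglyMeasurable,
    integral_withDensity_eq_integral_toReal_smul h2
      (Eventually.of_forall fun _ => ENNReal.ofReal_lt_top)]
  congr with p
  rw [ENNReal.toReal_ofReal (surfaceWeight_nonneg hm hβ s p), smul_eq_mul]

/-- Dominated convergence: the weight is bounded by `a_0/(2π)` and, as a function of the level,
jumps only when the level equals the residual, which has probability zero. This continuity is what
allows conditioning at every individual level. -/
lemma IsFreeField.continuous_integral_surfaceMeasure (hμ : IsFreeField L m β μ) (hm : 0 < m)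
    (hβ : 0 < β) (f : Omega L →ᵇ ℝ) :
    Continuous fun s => ∫ φ, f φ ∂(surfaceMeasure m β μ s) := by
  have := hμ.isProbabilityMeasure
  have hr := rate_pos (L := L) hm hβ 0
  simp_rw [integral_surfaceMeasure hm hβ _ f]
  rw [continuous_iff_continuousAt]
  intro s
  refine continuousAt_of_dominated (bound := fun _ => rate L m β 0 / (2 * Real.pi) * ‖f‖) ?_ ?_
    (integrable_const _) ?_
  · refine Eventually.of_forall fun t => Measurable.aestronglyMeasurable ?_
    exact (measurable_surfaceWeight_right m β t).mul
      (f.continuous.comp (continuous_surfacePoint_right t)).measurable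
  · refine Eventually.of_forall fun t => Eventually.of_forall fun p => ?_
    rw [norm_mul, Real.norm_of_nonneg (surfaceWeight_nonneg hm hβ t p)]
    exact mul_le_mul (polarWeight_le hr _) (f.norm_coe_le_norm _) (norm_nonneg _) (by positivity)
  · have hnull : ∀ᵐ p ∂(phaseMeasure μ), residual {0} p.1 ≠ s := by
      have h0 : ∀ᵐ φ ∂μ, residual {0} φ ≠ s := by
        rw [ae_iff]
        simpa using hμ.measure_residual_eq hm hβ {0} s
      exact Measure.quasiMeasurePreserving_fst.ae h0
    filter_upwards [hnull] with p hp
    have h1 : ContinuousAt (fun t => surfaceWeight L m β t p) s := by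
      have h2 : ContinuousAt (fun t : ℝ => t - residual {0} p.1) s := by fun_prop
      exact ContinuousAt.comp (f := fun t : ℝ => t - residual {0} p.1)
        (continuousAt_polarWeight _ (sub_ne_zero.2 (Ne.symm hp))) h2
    exact h1.mul (f.continuous.comp (continuous_surfacePoint.comp
      (Continuous.prodMk_left p))).continuousAt

variable (m β μ) in
/-- The density of the mass. -/
noncomputable def massDensity (s : ℝ) : ℝ := (surfaceMeasure m β μ s).real univ

lemma massDensity_of_nonpos {s : ℝ} (hs : s ≤ 0) : massDensity m β μ s = 0 := by
  simp [massDensity, surfaceMeasure_of_nonpos hs]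

lemma ofReal_massDensity [IsProbabilityMeasure μ] (hm : 0 < m) (hβ : 0 < β) (s : ℝ) :
    ENNReal.ofReal (massDensity m β μ s) = surfaceMeasure m β μ s univ := by
  have := isFiniteMeasure_surfaceMeasure (μ := μ) hm hβ s
  rw [massDensity, ofReal_measureReal]

lemma IsFreeField.continuous_massDensity (hμ : IsFreeField L m β μ) (hm : 0 < m)
    (hβ : 0 < β) : Continuous (massDensity m β μ) := by
  have := hμ.continuous_integral_surfaceMeasure hm hβ (BoundedContinuousFunction.const _ 1)
  simp only [BoundedContinuousFunction.const_apply, integral_const, smul_eq_mul, mul_one] at this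
  exact this

/-- The weight is strictly positive on the event that the mass is at most `s/2`, which has positive
probability. -/
lemma IsFreeField.massDensity_pos (hμ : IsFreeField L m β μ) (hm : 0 < m)
    (hβ : 0 < β) {s : ℝ} (hs : 0 < s) : 0 < massDensity m β μ s := by
  have := hμ.isProbabilityMeasure
  have hr := rate_pos (L := L) hm hβ 0
  rw [← ENNReal.ofReal_pos, ofReal_massDensity hm hβ, ← lintegral_one,
    lintegral_surfaceMeasure s measurable_const]
  simp_rw [mul_one]
  rw [lintegral_pos_iff_support (measurable_surfaceWeight_right m β s).ennreal_ofReal]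
  have h1 := hμ.measure_mass_le_pos hm hβ (half_pos hs)
  refine lt_of_lt_of_le ?_ (measure_mono (s := {φ : Omega L | mass L φ ≤ s / 2} ×ˢ univ) ?_)
  · rw [phaseMeasure, Measure.prod_prod, Measure.restrict_apply_univ, Real.volume_Ioo]
    refine ENNReal.mul_pos h1.ne' ?_
    simp [Real.pi_pos]
  · rintro ⟨φ, θ⟩ ⟨hφ, -⟩
    have hφ' : mass L φ ≤ s / 2 := hφ
    have h2 := residual_anti (Finset.empty_subset {0}) φ
    rw [residual_empty] at h2
    have h3 : 0 < s - residual {0} φ := by linarith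
    simp only [Function.mem_support, ne_eq, ENNReal.ofReal_eq_zero, not_le, surfaceWeight,
      polarWeight, if_pos h3]
    positivity

lemma IsFreeField.map_mass (hμ : IsFreeField L m β μ) (hm : 0 < m) (hβ : 0 < β) :
    μ.map (mass L) = volume.withDensity fun s => ENNReal.ofReal (massDensity m β μ s) := by
  have := hμ.isProbabilityMeasure
  ext B hB
  have hpre := (continuous_mass L).measurable hB
  rw [Measure.map_apply (continuous_mass L).measurable hB, withDensity_apply _ hB,
    ← lintegral_indicator_one hpre, hμ.lintegral_eq hm hβ (measurable_one.indicator hpre),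
    ← lintegral_indicator hB]
  congr with s
  have : ∫⁻ φ, (mass L ⁻¹' B).indicator 1 φ ∂(surfaceMeasure m β μ s)
      = ∫⁻ _, B.indicator 1 s ∂(surfaceMeasure m β μ s) := by
    apply lintegral_congr_ae
    filter_upwards [ae_mass_surfaceMeasure s] with φ hφ
    rw [← hφ]
    rfl
  rw [this, lintegral_const]
  by_cases hs : s ∈ B
  · simp [hs, ofReal_massDensity hm hβ]
  · simp [hs]

end Disintegration

/-! ### The Fejér kernel as an approximate identity. -/

section Fejer

/-- The trigonometric polynomial `∑_{k < ℓ} ∑_{|j| ≤ k} cos (j t)`. -/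
noncomputable def fejerSum (ℓ : ℕ) (t : ℝ) : ℝ :=
  ∑ k ∈ Finset.range ℓ, ∑ j ∈ Finset.Icc (-(k : ℤ)) (k : ℤ), Real.cos (j * t)

lemma continuous_fejerSum (ℓ : ℕ) : Continuous (fejerSum ℓ) := by
  unfold fejerSum
  fun_prop

lemma fejer_of_abs_le {ℓ : ℕ} {t : ℝ} (ht : |t| ≤ Real.pi) :
    fejer ℓ t = (2 * Real.pi * ℓ)⁻¹ * fejerSum ℓ t := by
  rw [fejer, if_pos ht, fejerSum]

lemma fejer_of_lt_abs {ℓ : ℕ} {t : ℝ} (ht : Real.pi < |t|) : fejer ℓ t = 0 := by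
  rw [fejer, if_neg (not_le.2 ht)]

lemma sin_half_mul_sum_cos (k : ℕ) (t : ℝ) :
    Real.sin (t / 2) * ∑ j ∈ Finset.Icc (-(k : ℤ)) (k : ℤ), Real.cos (j * t)
      = Real.sin ((k + 1 / 2) * t) := by
  induction k with
  | zero => simp; ring_nf
  | succ k ih =>
    have e : Finset.Icc (-((k + 1 : ℕ) : ℤ)) ((k + 1 : ℕ) : ℤ)
        = insert ((k + 1 : ℕ) : ℤ) (insert (-((k + 1 : ℕ) : ℤ)) (Finset.Icc (-(k : ℤ)) k)) := by
      ext x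
      simp only [Finset.mem_Icc, Finset.mem_insert]
      omega
    rw [e, Finset.sum_insert, Finset.sum_insert, mul_add, mul_add, ih]
    · have e1 : (((k + 1 : ℕ) : ℤ) : ℝ) * t = (k + 1) * t := by push_cast; ring
      have e2 : ((-((k + 1 : ℕ) : ℤ) : ℤ) : ℝ) * t = -((k + 1) * t) := by push_cast; ring
      have e3 : ((k : ℝ) + 1 / 2) * t = (k + 1) * t - t / 2 := by ring
      have e4 : (((k + 1 : ℕ) : ℝ) + 1 / 2) * t = (k + 1) * t + t / 2 := by push_cast; ring
      rw [e1, e2, e3, e4, Real.cos_neg, Real.sin_sub, Real.sin_add]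
      ring
    · simp
    · simp only [Finset.mem_insert, Finset.mem_Icc]
      omega

/-- Induction on `ℓ` from the closed form of the Dirichlet kernel. This formula gives both the
nonnegativity of the kernel and its decay like `1/ℓ` away from zero. -/
lemma sin_half_sq_mul_fejerSum (ℓ : ℕ) (t : ℝ) :
    Real.sin (t / 2) ^ 2 * fejerSum ℓ t = Real.sin (ℓ * t / 2) ^ 2 := by
  induction ℓ with
  | zero => simp [fejerSum]
  | succ ℓ ih =>
    have h : fejerSum (ℓ + 1) t
        = fejerSum ℓ t + ∑ j ∈ Finset.Icc (-(ℓ : ℤ)) (ℓ : ℤ), Real.cos (j * t) := by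
      rw [fejerSum, Finset.sum_range_succ, fejerSum]
    rw [h, mul_add, ih, pow_two (Real.sin (t / 2)), mul_assoc, sin_half_mul_sum_cos]
    have e1 : ((ℓ : ℝ) + 1 / 2) * t = ℓ * t / 2 + (ℓ * t / 2 + t / 2) := by ring
    have e2 : ((ℓ + 1 : ℕ) : ℝ) * t / 2 = ℓ * t / 2 + t / 2 := by push_cast; ring
    rw [e1, e2, Real.sin_add, Real.sin_add, Real.cos_add]
    have h1 := Real.sin_sq_add_cos_sq (t / 2)
    set A := Real.sin (ℓ * t / 2)
    set B := Real.cos (ℓ * t / 2)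
    set S := Real.sin (t / 2)
    set C := Real.cos (t / 2)
    linear_combination (-(A ^ 2)) * h1

lemma fejerSum_zero (ℓ : ℕ) : 0 ≤ fejerSum ℓ 0 := by
  simp only [fejerSum, mul_zero, Real.cos_zero]
  positivity

lemma sin_half_sq_pos {t : ℝ} (ht : |t| ≤ Real.pi) (h0 : t ≠ 0) : 0 < Real.sin (t / 2) ^ 2 := by
  have hpi := Real.pi_pos
  rw [abs_le] at ht
  have h : Real.sin (t / 2) ≠ 0 := by
    rw [Ne, Real.sin_eq_zero_iff_of_lt_of_lt (by linarith) (by linarith)]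
    exact div_ne_zero h0 two_ne_zero
  positivity

lemma fejer_nonneg (ℓ : ℕ) (t : ℝ) : 0 ≤ fejer ℓ t := by
  rcases le_or_gt |t| Real.pi with ht | ht
  · rw [fejer_of_abs_le ht]
    refine mul_nonneg (by positivity) ?_
    by_cases h0 : t = 0
    · rw [h0]; exact fejerSum_zero ℓ
    · have h1 := sin_half_sq_pos ht h0
      have h2 := sin_half_sq_mul_fejerSum ℓ t
      exact nonneg_of_mul_nonneg_right (h2 ▸ sq_nonneg _) h1
  · rw [fejer_of_lt_abs ht]

lemma measurable_fejer (ℓ : ℕ) : Measurable (fejer ℓ) := by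
  have : fejer ℓ = fun t => if |t| ≤ Real.pi then (2 * Real.pi * ℓ)⁻¹ * fejerSum ℓ t else 0 := by
    ext t; rfl
  rw [this]
  exact Measurable.ite (measurableSet_le (by fun_prop) measurable_const)
    ((continuous_fejerSum ℓ).measurable.const_mul _) measurable_const

lemma exists_fejer_le (ℓ : ℕ) : ∃ C, ∀ t, fejer ℓ t ≤ C := by
  obtain ⟨C, hC⟩ := (isCompact_Icc (a := -Real.pi) (b := Real.pi)).exists_bound_of_continuousOn
    (((continuous_fejerSum ℓ).const_mul ((2 * Real.pi * ℓ)⁻¹ : ℝ))).continuousOn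
  refine ⟨max C 0, fun t => ?_⟩
  rcases le_or_gt |t| Real.pi with ht | ht
  · rw [fejer_of_abs_le ht]
    exact (le_abs_self _).trans ((hC t (abs_le.1 ht)).trans (le_max_left _ _))
  · rw [fejer_of_lt_abs ht]
    exact le_max_right _ _

lemma integral_fejer {ℓ : ℕ} (hℓ : 1 ≤ ℓ) : ∫ t in Icc (-Real.pi) Real.pi, fejer ℓ t = 1 := by
  have hpi := Real.pi_pos
  have hcos : ∀ j : ℤ, ∫ t in (-Real.pi)..Real.pi, Real.cos (j * t)
      = if j = 0 then 2 * Real.pi else 0 := by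
    intro j
    split_ifs with hj
    · subst hj; simp; ring
    · have hj' : (j : ℝ) ≠ 0 := by exact_mod_cast hj
      rw [intervalIntegral.integral_comp_mul_left (fun x => Real.cos x) hj', integral_cos]
      simp [Real.sin_int_mul_pi]
  have h1 : ∫ t in Icc (-Real.pi) Real.pi, fejer ℓ t
      = ∫ t in (-Real.pi)..Real.pi, (2 * Real.pi * ℓ)⁻¹ * fejerSum ℓ t := by
    rw [intervalIntegral.integral_of_le (by linarith), ← integral_Icc_eq_integral_Ioc]
    exact setIntegral_congr_fun measurableSet_Icc fun t ht => fejer_of_abs_le (abs_le.2 ht)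
  have h2 : ∫ t in (-Real.pi)..Real.pi, fejerSum ℓ t = 2 * Real.pi * ℓ := by
    unfold fejerSum
    rw [intervalIntegral.integral_finsetSum fun k _ =>
      Continuous.intervalIntegrable (by fun_prop) _ _]
    have : ∀ k ∈ Finset.range ℓ, ∫ t in (-Real.pi)..Real.pi,
        ∑ j ∈ Finset.Icc (-(k : ℤ)) (k : ℤ), Real.cos (j * t) = 2 * Real.pi := by
      intro k _
      rw [intervalIntegral.integral_finsetSum fun j _ =>
        Continuous.intervalIntegrable (by fun_prop) _ _]
      simp_rw [hcos]
      simp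
    rw [Finset.sum_congr rfl this]
    simp
    ring
  have hℓ' : (ℓ : ℝ) ≠ 0 := by positivity
  rw [h1, intervalIntegral.integral_const_mul, h2, inv_mul_cancel₀ (by positivity)]

lemma fejer_le_of_le_abs {ℓ : ℕ} {δ t : ℝ} (hδ : 0 < δ) (ht : δ ≤ |t|) (ht' : |t| ≤ Real.pi) :
    fejer ℓ t ≤ (2 * Real.pi * Real.sin (δ / 2) ^ 2)⁻¹ * (ℓ : ℝ)⁻¹ := by
  have hpi := Real.pi_pos
  have hs : 0 < Real.sin (δ / 2) := Real.sin_pos_of_pos_of_lt_pi (by linarith) (by linarith)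
  have hsin : Real.sin (δ / 2) ^ 2 ≤ Real.sin (t / 2) ^ 2 := by
    have h1 : Real.sin (δ / 2) ≤ Real.sin (|t| / 2) :=
      Real.sin_le_sin_of_le_of_le_pi_div_two (by linarith) (by linarith) (by linarith)
    have h2 : Real.sin (|t| / 2) ^ 2 = Real.sin (t / 2) ^ 2 := by
      rcases abs_cases t with h | h <;> rw [h.1]
      rw [neg_div, Real.sin_neg, neg_sq]
    rw [← h2]
    gcongr
  have h3 : Real.sin (δ / 2) ^ 2 * fejerSum ℓ t ≤ 1 := by
    have h0 : 0 ≤ fejerSum ℓ t := by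
      have h4 := sin_half_sq_mul_fejerSum ℓ t
      exact nonneg_of_mul_nonneg_right (h4 ▸ sq_nonneg _)
        (lt_of_lt_of_le (by positivity) hsin)
    calc Real.sin (δ / 2) ^ 2 * fejerSum ℓ t ≤ Real.sin (t / 2) ^ 2 * fejerSum ℓ t := by gcongr
      _ = Real.sin (ℓ * t / 2) ^ 2 := sin_half_sq_mul_fejerSum ℓ t
      _ ≤ 1 := Real.sin_sq_le_one _
  rw [fejer_of_abs_le ht']
  have h5 : fejerSum ℓ t ≤ (Real.sin (δ / 2) ^ 2)⁻¹ := by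
    rwa [inv_eq_one_div, le_div_iff₀ (by positivity), mul_comm]
  calc (2 * Real.pi * ℓ)⁻¹ * fejerSum ℓ t ≤ (2 * Real.pi * ℓ)⁻¹ * (Real.sin (δ / 2) ^ 2)⁻¹ := by
        gcongr
    _ = _ := by rw [mul_inv, mul_inv, mul_inv]; ring

/-- The Fejér kernel is an approximate identity. -/
lemma tendsto_integral_fejer {g : ℝ → ℝ} (hg : Continuous g) (n : ℝ) :
    Tendsto (fun ℓ : ℕ => ∫ s, fejer ℓ (n - s) * g s) atTop (𝓝 (g n)) := by
  have hpi := Real.pi_pos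
  have h1 : ∀ ℓ : ℕ, ∫ s, fejer ℓ (n - s) * g s
      = ∫ t in Icc (-Real.pi) Real.pi, fejer ℓ t • g (n - t) := by
    intro ℓ
    rw [← integral_indicator measurableSet_Icc,
      ← integral_sub_left_eq_self (fun s => fejer ℓ (n - s) * g s) volume n]
    congr with t
    by_cases ht : t ∈ Icc (-Real.pi) Real.pi
    · rw [indicator_of_mem ht, sub_sub_cancel, smul_eq_mul]
    · rw [indicator_of_notMem ht, sub_sub_cancel, fejer_of_lt_abs, zero_mul]
      rw [← not_le, abs_le]
      exact ht
  simp_rw [h1]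
  have hmem : (0 : ℝ) ∈ Icc (-Real.pi) Real.pi := ⟨by linarith, hpi.le⟩
  refine tendsto_setIntegral_peak_smul_of_integrableOn_of_tendsto (x₀ := 0) measurableSet_Icc
    (t := Icc (-Real.pi) Real.pi) measurableSet_Icc Subset.rfl self_mem_nhdsWithin
    (by simp) (Eventually.of_forall fun ℓ t _ => fejer_nonneg ℓ t) ?_ ?_
    (Eventually.of_forall fun ℓ => (measurable_fejer ℓ).aestronglyMeasurable) ?_ ?_
  · intro u hu h0
    obtain ⟨δ, hδ, hball⟩ := Metric.isOpen_iff.1 hu 0 h0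
    have hδ' : ∀ t ∈ Icc (-Real.pi) Real.pi \ u, δ ≤ |t| := by
      intro t ht
      by_contra! h
      exact ht.2 (hball (by simpa using h))
    rw [Metric.tendstoUniformlyOn_iff]
    intro ε hε
    have hlim : Tendsto (fun ℓ : ℕ => (2 * Real.pi * Real.sin (δ / 2) ^ 2)⁻¹ * (ℓ : ℝ)⁻¹) atTop
        (𝓝 0) := by
      have := (tendsto_inv_atTop_nhds_zero_nat (𝕜 := ℝ)).const_mul
        ((2 * Real.pi * Real.sin (δ / 2) ^ 2)⁻¹ : ℝ)
      rwa [mul_zero] at this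
    filter_upwards [hlim.eventually_lt_const hε] with ℓ hℓ t ht
    rw [Pi.zero_apply, dist_comm, Real.dist_0_eq_abs, abs_of_nonneg (fejer_nonneg ℓ t)]
    exact (fejer_le_of_le_abs hδ (hδ' t ht) (abs_le.2 ht.1)).trans_lt hℓ
  · refine tendsto_const_nhds.congr' ?_
    -- The index `ℓ = 0` is excluded because that kernel is identically zero.
    filter_upwards [eventually_ge_atTop 1] with ℓ hℓ
    exact (integral_fejer hℓ).symm
  · exact (by fun_prop : Continuous fun t => g (n - t)).continuousOn.integrableOn_Icc
  · have : Continuous fun t => g (n - t) := by fun_prop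
    simpa using (this.tendsto 0).mono_left nhdsWithin_le_nhds

end Fejer

/-! ### Weak convergence of the regularized laws. -/

section WeakConvergence

variable {L : ℝ} [Fact (0 < L)] {m β : ℝ} {μ : Measure (Omega L)}

lemma measurable_fejer_mass (n : ℝ) (ℓ : ℕ) :
    Measurable fun φ : Omega L => fejer ℓ (n - mass L φ) :=
  (measurable_fejer ℓ).comp (measurable_const.sub (continuous_mass L).measurable)

lemma integrable_fejer_mass_mul [IsProbabilityMeasure μ] (n : ℝ) (ℓ : ℕ) (f : Omega L →ᵇ ℝ) :
    Integrable (fun φ => fejer ℓ (n - mass L φ) * f φ) μ := by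
  obtain ⟨C, hC⟩ := exists_fejer_le ℓ
  refine Integrable.bdd_mul (c := C) (f.integrable μ)
    (measurable_fejer_mass n ℓ).aestronglyMeasurable (Eventually.of_forall fun φ => ?_)
  rw [Real.norm_of_nonneg (fejer_nonneg _ _)]
  exact hC _

/-- The Fejér factor is constant on each level set, so disintegration turns the integral over fields
into a convolution on the line. -/
lemma IsFreeField.integral_fejer_mass_mul (hμ : IsFreeField L m β μ) (hm : 0 < m) (hβ : 0 < β)
    (n : ℝ) (ℓ : ℕ) (f : Omega L →ᵇ ℝ) :
    ∫ φ, fejer ℓ (n - mass L φ) * f φ ∂μ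
      = ∫ s, fejer ℓ (n - s) * ∫ φ, f φ ∂(surfaceMeasure m β μ s) := by
  have := hμ.isProbabilityMeasure
  rw [hμ.integral_eq hm hβ (integrable_fejer_mass_mul n ℓ f)]
  congr with s
  rw [← integral_const_mul]
  apply integral_congr_ae
  filter_upwards [ae_mass_surfaceMeasure s] with φ hφ
  rw [hφ]

lemma IsFreeField.integral_fejer_mass (hμ : IsFreeField L m β μ) (hm : 0 < m) (hβ : 0 < β)
    (n : ℝ) (ℓ : ℕ) :
    ∫ φ, fejer ℓ (n - mass L φ) ∂μ = ∫ s, fejer ℓ (n - s) * massDensity m β μ s := by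
  have h := hμ.integral_fejer_mass_mul hm hβ n ℓ (BoundedContinuousFunction.const _ 1)
  simpa [massDensity] using h

lemma lintegral_fejer_mass [IsProbabilityMeasure μ] (n : ℝ) (ℓ : ℕ) :
    ∫⁻ φ, ENNReal.ofReal (fejer ℓ (n - mass L φ)) ∂μ
      = ENNReal.ofReal (∫ φ, fejer ℓ (n - mass L φ) ∂μ) := by
  refine (ofReal_integral_eq_lintegral_ofReal ?_
    (Eventually.of_forall fun _ => fejer_nonneg _ _)).symm
  simpa using integrable_fejer_mass_mul (μ := μ) n ℓ (BoundedContinuousFunction.const _ 1)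

lemma IsFreeField.integral_fejer_mass_pos (hμ : IsFreeField L m β μ) (hm : 0 < m) (hβ : 0 < β)
    {n : ℝ} (hn : 0 < n) {ℓ : ℕ} (hℓ : 1 ≤ ℓ) : 0 < ∫ φ, fejer ℓ (n - mass L φ) ∂μ := by
  have := hμ.isProbabilityMeasure
  have hpi := Real.pi_pos
  have hint : Integrable (fun φ => fejer ℓ (n - mass L φ)) μ := by
    simpa using integrable_fejer_mass_mul (μ := μ) n ℓ (BoundedContinuousFunction.const _ 1)
  rw [integral_pos_iff_support_of_nonneg (fun _ => fejer_nonneg _ _) hint]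
  have h0 : 0 < fejerSum ℓ 0 := by
    simp only [fejerSum, mul_zero, Real.cos_zero, Finset.sum_const]
    refine Finset.sum_pos (fun k _ => ?_) ⟨0, Finset.mem_range.2 hℓ⟩
    simp
    positivity
  have hU : IsOpen {t : ℝ | 0 < fejerSum ℓ t ∧ |t| < Real.pi} :=
    (isOpen_lt continuous_const (continuous_fejerSum ℓ)).inter
      (isOpen_lt continuous_abs continuous_const)
  obtain ⟨δ, hδ, hball⟩ := Metric.isOpen_iff.1 hU 0 ⟨h0, by simpa using hpi⟩
  have hB : MeasurableSet (Metric.ball n δ) := Metric.isOpen_ball.measurableSet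
  have hsub : mass L ⁻¹' (Metric.ball n δ)
      ⊆ Function.support fun φ => fejer ℓ (n - mass L φ) := by
    intro φ hφ
    have h1 : n - mass L φ ∈ Metric.ball (0 : ℝ) δ := by
      rw [mem_ball_zero_iff, ← dist_eq_norm, dist_comm]; exact hφ
    obtain ⟨h2, h3⟩ := hball h1
    have hℓ' : (0 : ℝ) < ℓ := by positivity
    rw [Function.mem_support, fejer_of_abs_le h3.le]
    positivity
  refine lt_of_lt_of_le ?_ (measure_mono hsub)
  rw [← Measure.map_apply (continuous_mass L).measurable hB, hμ.map_mass hm hβ,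
    withDensity_apply _ hB,
    setLIntegral_pos_iff (hμ.continuous_massDensity hm hβ).measurable.ennreal_ofReal]
  -- Only levels just above `n` are used: they are positive, so the density of the mass is positive
  -- there.
  refine lt_of_lt_of_le ?_ (measure_mono (s := Ioo n (n + δ)) ?_)
  · simp [hδ]
  · intro s hs
    refine ⟨?_, ?_⟩
    · have := hμ.massDensity_pos hm hβ (hn.trans hs.1)
      simpa using this
    · rw [Metric.mem_ball, Real.dist_eq, abs_of_pos (by linarith [hs.1])]
      linarith [hs.2]

lemma IsFreeField.isProbabilityMeasure_fejerLaw (hμ : IsFreeField L m β μ) (hm : 0 < m)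
    (hβ : 0 < β) {n : ℝ} (hn : 0 < n) {ℓ : ℕ} (hℓ : 1 ≤ ℓ) :
    IsProbabilityMeasure (fejerLaw L μ n ℓ) := by
  have := hμ.isProbabilityMeasure
  have hpos := hμ.integral_fejer_mass_pos hm hβ hn hℓ
  constructor
  rw [fejerLaw, Measure.smul_apply, withDensity_apply _ MeasurableSet.univ, Measure.restrict_univ,
    smul_eq_mul, lintegral_fejer_mass]
  exact ENNReal.inv_mul_cancel (by simpa using hpos) ENNReal.ofReal_ne_top

lemma IsFreeField.integral_fejerLaw (hμ : IsFreeField L m β μ) (hm : 0 < m) (hβ : 0 < β)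
    (n : ℝ) (ℓ : ℕ) (f : Omega L →ᵇ ℝ) :
    ∫ φ, f φ ∂(fejerLaw L μ n ℓ) = (∫ s, fejer ℓ (n - s) * massDensity m β μ s)⁻¹ *
      ∫ s, fejer ℓ (n - s) * ∫ φ, f φ ∂(surfaceMeasure m β μ s) := by
  have := hμ.isProbabilityMeasure
  have hnn : 0 ≤ ∫ φ, fejer ℓ (n - mass L φ) ∂μ := integral_nonneg fun _ => fejer_nonneg _ _
  rw [fejerLaw, integral_smul_measure, lintegral_fejer_mass,
    integral_withDensity_eq_integral_toReal_smul (measurable_fejer_mass n ℓ).ennreal_ofReal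
      (Eventually.of_forall fun _ => ENNReal.ofReal_lt_top),
    ENNReal.toReal_inv, ENNReal.toReal_ofReal hnn, hμ.integral_fejer_mass hm hβ,
    ← hμ.integral_fejer_mass_mul hm hβ, smul_eq_mul]
  congr with φ
  rw [ENNReal.toReal_ofReal (fejer_nonneg _ _), smul_eq_mul]

/-- A quotient of two Fejér convolutions of continuous functions, whose denominator tends to the
positive number `ρ(n)`. -/
lemma IsFreeField.tendsto_integral_fejerLaw (hμ : IsFreeField L m β μ) (hm : 0 < m) (hβ : 0 < β)
    {n : ℝ} (hn : 0 < n) (f : Omega L →ᵇ ℝ) :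
    Tendsto (fun ℓ : ℕ => ∫ φ, f φ ∂(fejerLaw L μ n ℓ)) atTop
      (𝓝 ((massDensity m β μ n)⁻¹ * ∫ φ, f φ ∂(surfaceMeasure m β μ n))) := by
  simp_rw [hμ.integral_fejerLaw hm hβ n _ f]
  exact ((tendsto_integral_fejer (hμ.continuous_massDensity hm hβ) n).inv₀
    (hμ.massDensity_pos hm hβ hn).ne').mul
    (tendsto_integral_fejer (hμ.continuous_integral_surfaceMeasure hm hβ f) n)

end WeakConvergence

/-! ### Smoothness of the density of the mass. -/

section Smoothness

variable {L : ℝ} [Fact (0 < L)] {m β : ℝ} {μ : Measure (Omega L)}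

variable (m β μ) in
/-- The density of `residual F`, obtained by averaging over the mode `k ∉ F`. -/
noncomputable def residualDensity (F : Finset ℤ) (k : ℤ) (s : ℝ) : ℝ :=
  ∫ φ, 2 * Real.pi * polarWeight (rate L m β k) (s - residual (insert k F) φ) ∂μ

lemma residualDensity_nonneg (hm : 0 < m) (hβ : 0 < β) (F : Finset ℤ) (k : ℤ) (s : ℝ) :
    0 ≤ residualDensity m β μ F k s :=
  integral_nonneg fun _ => mul_nonneg (by positivity) (polarWeight_nonneg (rate_pos hm hβ k) _)

lemma residualDensity_of_nonpos (F : Finset ℤ) (k : ℤ) {s : ℝ} (hs : s ≤ 0) :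
    residualDensity m β μ F k s = 0 := by
  have : ∀ φ : Omega L, ¬ 0 < s - residual (insert k F) φ := fun φ => by
    have := residual_nonneg (insert k F) φ
    linarith
  simp [residualDensity, polarWeight, this]

lemma measurable_polarWeight_residual (a : ℝ) (F : Finset ℤ) :
    Measurable fun p : ℝ × Omega L => polarWeight a (p.1 - residual F p.2) :=
  (measurable_polarWeight a).comp
    (continuous_fst.sub ((continuous_residual F).comp continuous_snd)).measurable

lemma norm_polarWeight_le {a : ℝ} (ha : 0 < a) (t : ℝ) : ‖2 * Real.pi * polarWeight a t‖ ≤ a := by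
  have hpi := Real.pi_pos
  rw [Real.norm_of_nonneg (mul_nonneg (by positivity) (polarWeight_nonneg ha t))]
  calc 2 * Real.pi * polarWeight a t ≤ 2 * Real.pi * (a / (2 * Real.pi)) := by
        gcongr
        exact polarWeight_le ha t
    _ = a := by field_simp

lemma ofReal_residualDensity [IsProbabilityMeasure μ] (hm : 0 < m) (hβ : 0 < β)
    (F : Finset ℤ) (k : ℤ) (s : ℝ) :
    ENNReal.ofReal (residualDensity m β μ F k s) = ∫⁻ φ, ENNReal.ofReal
      (2 * Real.pi * polarWeight (rate L m β k) (s - residual (insert k F) φ)) ∂μ := by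
  have hr := rate_pos (L := L) hm hβ k
  refine ofReal_integral_eq_lintegral_ofReal ?_
    (Eventually.of_forall fun _ => mul_nonneg (by positivity) (polarWeight_nonneg hr _))
  refine Integrable.of_bound (C := rate L m β k) ?_
    (Eventually.of_forall fun _ => norm_polarWeight_le hr _)
  exact (((measurable_polarWeight_residual _ _).comp measurable_prodMk_left).const_mul
    _).aestronglyMeasurable

lemma IsFreeField.continuous_residualDensity (hμ : IsFreeField L m β μ) (hm : 0 < m)
    (hβ : 0 < β) (F : Finset ℤ) (k : ℤ) : Continuous (residualDensity m β μ F k) := by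
  have := hμ.isProbabilityMeasure
  have hr := rate_pos (L := L) hm hβ k
  rw [continuous_iff_continuousAt]
  intro s
  refine continuousAt_of_dominated (bound := fun _ => rate L m β k) ?_ ?_ (integrable_const _) ?_
  · exact Eventually.of_forall fun t =>
      (((measurable_polarWeight_residual _ _).comp measurable_prodMk_left).const_mul
        _).aestronglyMeasurable
  · exact Eventually.of_forall fun t => Eventually.of_forall fun _ => norm_polarWeight_le hr _
  · have h0 : ∀ᵐ φ ∂μ, residual (insert k F) φ ≠ s := by
      rw [ae_iff]
      simpa using hμ.measure_residual_eq hm hβ (insert k F) s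
    filter_upwards [h0] with φ hφ
    have h2 : ContinuousAt (fun t : ℝ => t - residual (insert k F) φ) s := by fun_prop
    exact (ContinuousAt.comp (f := fun t : ℝ => t - residual (insert k F) φ)
      (continuousAt_polarWeight _ (sub_ne_zero.2 (Ne.symm hφ))) h2).const_mul _

lemma lintegral_cgauss_normSq {a : ℝ} (ha : 0 < a) {g : ℝ → ℝ≥0∞} (hg : Measurable g) :
    ∫⁻ w, g (‖w‖ ^ 2) ∂(cgauss a)
      = ∫⁻ t, ENNReal.ofReal (2 * Real.pi * polarWeight a t) * g t := by
  rw [lintegral_cgauss_polarWeight ha (F := fun w => g (‖w‖ ^ 2)) (hg.comp (by fun_prop))]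
  congr with t
  by_cases ht : 0 < t
  · simp_rw [norm_polarPoint_sq ht.le]
    rw [lintegral_const, Measure.restrict_apply_univ, Real.volume_Ioo,
      ENNReal.ofReal_mul (by positivity)]
    ring_nf
  · simp [polarWeight, ht]

lemma IsFreeField.map_residual (hμ : IsFreeField L m β μ) (hm : 0 < m) (hβ : 0 < β)
    {F : Finset ℤ} {k : ℤ} (hk : k ∉ F) :
    μ.map (residual F)
      = volume.withDensity fun s => ENNReal.ofReal (residualDensity m β μ F k s) := by
  have := hμ.isProbabilityMeasure
  have hr := rate_pos (L := L) hm hβ k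
  ext B hB
  have hres := (continuous_residual (L := L) F).measurable
  have hpre := hres hB
  have hg : Measurable (B.indicator (1 : ℝ → ℝ≥0∞)) := measurable_one.indicator hB
  have hw : ∀ φ : Omega L, ∫⁻ w, (residual F ⁻¹' B).indicator 1 (resample k w φ)
        ∂(cgauss (rate L m β k))
      = ∫⁻ s, ENNReal.ofReal (2 * Real.pi *
          polarWeight (rate L m β k) (s - residual (insert k F) φ)) * B.indicator 1 s := by
    intro φ
    have h1 : ∀ w, (residual F ⁻¹' B).indicator (1 : Omega L → ℝ≥0∞) (resample k w φ)
        = B.indicator 1 (‖w‖ ^ 2 + residual (insert k F) φ) := by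
      intro w
      rw [← residual_resample hk]
      rfl
    simp_rw [h1]
    rw [lintegral_cgauss_normSq hr (g := fun t => B.indicator 1 (t + residual (insert k F) φ))
      (hg.comp (by fun_prop)), ← lintegral_sub_right_eq_self _ (residual (insert k F) φ)]
    simp
  rw [Measure.map_apply hres hB, withDensity_apply _ hB, ← lintegral_indicator_one hpre,
    hμ.lintegral_resample hm hβ k (measurable_one.indicator hpre)]
  simp_rw [hw]
  rw [lintegral_lintegral_swap, ← lintegral_indicator hB]
  · congr with s
    by_cases hs : s ∈ B
    · simp [hs, ofReal_residualDensity hm hβ]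
    · simp [hs]
  · have h2 : Measurable fun p : Omega L × ℝ =>
        polarWeight (rate L m β k) (p.2 - residual (insert k F) p.1) :=
      (measurable_polarWeight_residual _ _).comp measurable_swap
    exact ((h2.const_mul _).ennreal_ofReal.mul (hg.comp measurable_snd)).aemeasurable

/-- The residual is an exponential variable plus an independent residual with one more mode removed,
so its density is a convolution. Factoring `e^(-a(s-x)) = e^(-as) e^(ax)` takes `s` out of the
integrand and leaves a primitive, whence the gain of one derivative. -/
lemma IsFreeField.residualDensity_eq (hμ : IsFreeField L m β μ) (hm : 0 < m) (hβ : 0 < β)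
    {F : Finset ℤ} {k l : ℤ} (hl : l ∉ insert k F) (s : ℝ) :
    residualDensity m β μ F k s = rate L m β k * Real.exp (-rate L m β k * s) *
      ∫ x in (0 : ℝ)..s, Real.exp (rate L m β k * x) * residualDensity m β μ (insert k F) l x := by
  have := hμ.isProbabilityMeasure
  have hpi := Real.pi_pos
  set a := rate L m β k with ha
  set q := residualDensity m β μ (insert k F) l with hq
  have hres := (continuous_residual (L := L) (insert k F)).measurable
  have h1 : residualDensity m β μ F k s
      = ∫ x, 2 * Real.pi * polarWeight a (s - x) ∂(μ.map (residual (insert k F))) := by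
    rw [integral_map hres.aemeasurable]
    · rfl
    · exact (((measurable_polarWeight a).comp
        (measurable_const.sub measurable_id)).const_mul _).aestronglyMeasurable
  have hqm : Measurable q := (hμ.continuous_residualDensity hm hβ (insert k F) l).measurable
  rw [h1, hμ.map_residual hm hβ hl, integral_withDensity_eq_integral_toReal_smul
    hqm.ennreal_ofReal (Eventually.of_forall fun _ => ENNReal.ofReal_lt_top)]
  have h2 : ∀ x, (ENNReal.ofReal (q x)).toReal • (2 * Real.pi * polarWeight a (s - x))
      = (Ioo 0 s).indicator (fun x => a * Real.exp (-a * s) * (Real.exp (a * x) * q x)) x := by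
    intro x
    rw [show (ENNReal.ofReal (q x)).toReal = q x from
      ENNReal.toReal_ofReal (residualDensity_nonneg hm hβ _ _ _), smul_eq_mul]
    by_cases hx : x ∈ Ioo 0 s
    · rw [indicator_of_mem hx, polarWeight, if_pos (sub_pos.2 hx.2),
        show -a * (s - x) = -a * s + a * x by ring, Real.exp_add]
      field_simp
    · rw [indicator_of_notMem hx]
      rcases le_or_gt x 0 with h0 | h0
      · rw [hq, residualDensity_of_nonpos _ _ h0, zero_mul]
      · have : ¬ 0 < s - x := fun h => hx ⟨h0, by linarith⟩
        simp [polarWeight, this]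
  simp_rw [h2]
  rw [integral_indicator measurableSet_Ioo, integral_const_mul]
  congr 1
  rcases le_total 0 s with hs | hs
  · rw [intervalIntegral.integral_of_le hs, integral_Ioc_eq_integral_Ioo]
  · rw [Ioo_eq_empty (not_lt.2 hs), setIntegral_empty]
    symm
    rw [intervalIntegral.integral_congr (g := fun _ => 0)]
    · simp
    · intro x hx
      rw [uIcc_of_ge hs] at hx
      simp [hq, residualDensity_of_nonpos _ _ hx.2]

lemma IsFreeField.contDiff_residualDensity (hμ : IsFreeField L m β μ) (hm : 0 < m) (hβ : 0 < β)
    (n : ℕ) (F : Finset ℤ) (k : ℤ) : ContDiff ℝ n (residualDensity m β μ F k) := by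
  induction n generalizing F k with
  | zero =>
    exact contDiff_zero.2 (hμ.continuous_residualDensity hm hβ F k)
  | succ n ih =>
    -- A fresh mode is available at every stage because there are infinitely many; the induction
    -- must therefore range over all `F` and `k`.
    obtain ⟨l, hl⟩ := Infinite.exists_notMem_finset (insert k F)
    rw [funext (hμ.residualDensity_eq hm hβ hl)]
    have hc : ContDiff ℝ n fun x =>
        Real.exp (rate L m β k * x) * residualDensity m β μ (insert k F) l x :=
      ContDiff.mul (by fun_prop) (ih (insert k F) l)
    have hd : ∀ s, HasDerivAt (fun s => ∫ x in (0 : ℝ)..s,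
        Real.exp (rate L m β k * x) * residualDensity m β μ (insert k F) l x)
        (Real.exp (rate L m β k * s) * residualDensity m β μ (insert k F) l s) s :=
      fun s => hc.continuous.integral_hasStrictDerivAt 0 s |>.hasDerivAt
    refine ContDiff.mul (by fun_prop) ?_
    push_cast
    rw [contDiff_succ_iff_deriv]
    refine ⟨fun s => (hd s).differentiableAt, by simp, ?_⟩
    rw [funext fun s => (hd s).deriv]
    exact hc

lemma IsFreeField.massDensity_eq (hμ : IsFreeField L m β μ) (hm : 0 < m) (hβ : 0 < β) :
    massDensity m β μ = residualDensity m β μ ∅ 0 := by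
  have := hμ.isProbabilityMeasure
  ext s
  have hr := rate_pos (L := L) hm hβ 0
  rw [← ENNReal.toReal_ofReal (residualDensity_nonneg (L := L) (μ := μ) hm hβ ∅ 0 s),
    ofReal_residualDensity hm hβ, massDensity, Measure.real, ← lintegral_one,
    lintegral_surfaceMeasure s measurable_const, phaseMeasure]
  congr 1
  rw [lintegral_prod _ ((measurable_surfaceWeight_right m β s).ennreal_ofReal.mul_const
    1).aemeasurable]
  congr with φ
  simp only [surfaceWeight, mul_one, lintegral_const, Measure.restrict_apply_univ,
    Real.volume_Ioo, insert_empty_eq]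
  rw [mul_comm, ← ENNReal.ofReal_mul (by linarith [Real.pi_pos])]
  ring_nf

lemma IsFreeField.contDiff_massDensity (hμ : IsFreeField L m β μ) (hm : 0 < m) (hβ : 0 < β) :
    ContDiff ℝ ∞ (massDensity m β μ) := by
  rw [hμ.massDensity_eq hm hβ, contDiff_infty]
  exact fun n => hμ.contDiff_residualDensity hm hβ n ∅ 0

end Smoothness

/-! ### Exponential moments of quadratic forms in the modes. -/

section ExponentialMoments

variable {L : ℝ} [Fact (0 < L)] {m β : ℝ} {μ : Measure (Omega L)} {b : ℤ → ℝ}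

lemma inv_one_sub_le_exp {x : ℝ} (h0 : 0 ≤ x) (h1 : x ≤ 1 / 2) : 1 / (1 - x) ≤ Real.exp (2 * x) := by
  rw [div_le_iff₀ (by linarith)]
  nlinarith [Real.add_one_le_exp (2 * x)]

lemma lintegral_exp_normSq_cgauss_le {a c : ℝ} (ha : 0 < a) (hc : 0 ≤ c) (hca : c ≤ a / 2) :
    ∫⁻ w, ENNReal.ofReal (Real.exp (c * ‖w‖ ^ 2)) ∂(cgauss a)
      ≤ ENNReal.ofReal (Real.exp (2 * (c / a))) := by
  have h := lintegral_rexp_cgauss ha (show c < a by linarith) 0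
  simp only [map_zero, zero_mul, Complex.zero_re, add_zero, norm_zero, ne_eq, OfNat.ofNat_ne_zero,
    not_false_eq_true, zero_pow, zero_div, Real.exp_zero, mul_one] at h
  rw [h]
  apply ENNReal.ofReal_le_ofReal
  have h2 : a / (a - c) = 1 / (1 - c / a) := by
    have : a - c ≠ 0 := by linarith
    field_simp
  rw [h2]
  exact inv_one_sub_le_exp (by positivity) (by rw [div_le_iff₀ ha]; linarith)

/-- Resampling splits off one factor at a time. Each equals `1/(1 - b_k/a_k)`, which is at most
`exp(2 b_k/a_k)` since `b_k ≤ a_k/2`; this makes the product summable in the exponent. -/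
lemma IsFreeField.lintegral_exp_sum_le (hμ : IsFreeField L m β μ) (hm : 0 < m) (hβ : 0 < β)
    (hb : ∀ k, 0 ≤ b k) (hb' : ∀ k, b k ≤ rate L m β k / 2) (F : Finset ℤ) :
    ∫⁻ φ, ENNReal.ofReal (Real.exp (∑ k ∈ F, b k * ‖mode L k φ‖ ^ 2)) ∂μ
      ≤ ENNReal.ofReal (Real.exp (∑ k ∈ F, 2 * (b k / rate L m β k))) := by
  have := hμ.isProbabilityMeasure
  have hmeas : ∀ F : Finset ℤ, Measurable fun φ : Omega L =>
      ENNReal.ofReal (Real.exp (∑ k ∈ F, b k * ‖mode L k φ‖ ^ 2)) := fun F =>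
    (Real.continuous_exp.comp (continuous_finsetSum _ fun k _ =>
      ((continuous_mode L k).norm.pow 2).const_mul _)).measurable.ennreal_ofReal
  induction F using Finset.induction_on with
  | empty => simp
  | insert k F hk ih =>
    have hr := rate_pos (L := L) hm hβ k
    rw [hμ.lintegral_resample hm hβ k (hmeas _)]
    have h1 : ∀ (φ : Omega L) (w : ℂ),
        ENNReal.ofReal (Real.exp (∑ j ∈ insert k F, b j * ‖mode L j (resample k w φ)‖ ^ 2))
        = ENNReal.ofReal (Real.exp (∑ j ∈ F, b j * ‖mode L j φ‖ ^ 2)) *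
          ENNReal.ofReal (Real.exp (b k * ‖w‖ ^ 2)) := by
      intro φ w
      rw [Finset.sum_insert hk, mode_resample, if_pos rfl, ← ENNReal.ofReal_mul (by positivity),
        ← Real.exp_add, add_comm]
      congr 3
      exact Finset.sum_congr rfl fun j hj => by
        rw [mode_resample, if_neg (ne_of_mem_of_not_mem hj hk)]
    simp_rw [h1]
    calc ∫⁻ φ, ∫⁻ w, ENNReal.ofReal (Real.exp (∑ j ∈ F, b j * ‖mode L j φ‖ ^ 2)) *
          ENNReal.ofReal (Real.exp (b k * ‖w‖ ^ 2)) ∂(cgauss (rate L m β k)) ∂μ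
        ≤ ∫⁻ φ, ENNReal.ofReal (Real.exp (∑ j ∈ F, b j * ‖mode L j φ‖ ^ 2)) *
          ENNReal.ofReal (Real.exp (2 * (b k / rate L m β k))) ∂μ := by
          refine lintegral_mono fun φ => ?_
          rw [lintegral_const_mul _ (by fun_prop)]
          gcongr
          exact lintegral_exp_normSq_cgauss_le hr (hb k) (hb' k)
      _ ≤ ENNReal.ofReal (Real.exp (∑ k ∈ F, 2 * (b k / rate L m β k))) *
          ENNReal.ofReal (Real.exp (2 * (b k / rate L m β k))) := by
          rw [lintegral_mul_const _ (hmeas F)]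
          gcongr
      _ = _ := by
          rw [← ENNReal.ofReal_mul (by positivity), ← Real.exp_add, Finset.sum_insert hk, add_comm]

variable (b) in
/-- `exp (∑ b_k |X_k|²)`, with values in `[0, ∞]`. -/
noncomputable def expQuad (φ : Omega L) : ℝ≥0∞ :=
  EReal.exp ((∑' k : ℤ, ENNReal.ofReal (b k * ‖mode L k φ‖ ^ 2) : ℝ≥0∞) : EReal)

lemma exp_coe_ofReal {x : ℝ} (hx : 0 ≤ x) :
    EReal.exp ((ENNReal.ofReal x : ℝ≥0∞) : EReal) = ENNReal.ofReal (Real.exp x) := by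
  rw [EReal.coe_ennreal_ofReal, max_eq_left hx, EReal.exp_coe]

lemma measurable_expQuad : Measurable (expQuad (L := L) b) := by
  have h : Measurable fun φ : Omega L => ∑' k : ℤ, ENNReal.ofReal (b k * ‖mode L k φ‖ ^ 2) :=
    Measurable.tsum fun k =>
      ((continuous_mode L k).norm.pow 2).measurable.const_mul _ |>.ennreal_ofReal
  exact EReal.measurable_exp.comp (measurable_coe_ennreal_ereal.comp h)

lemma tendsto_expQuad (hb : ∀ k, 0 ≤ b k) (φ : Omega L) :
    Tendsto (fun J => ENNReal.ofReal (Real.exp (∑ k ∈ dyadicBall J, b k * ‖mode L k φ‖ ^ 2)))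
      atTop (𝓝 (expQuad b φ)) := by
  have h1 : Tendsto (fun J => ∑ k ∈ dyadicBall J, ENNReal.ofReal (b k * ‖mode L k φ‖ ^ 2)) atTop
      (𝓝 (∑' k : ℤ, ENNReal.ofReal (b k * ‖mode L k φ‖ ^ 2))) :=
    ENNReal.summable.hasSum.comp tendsto_dyadicBall
  have h2 := ((ENNReal.continuous_exp.comp continuous_coe_ennreal_ereal).tendsto _).comp h1
  refine h2.congr fun J => ?_
  have hnn : ∀ k, 0 ≤ b k * ‖mode L k φ‖ ^ 2 := fun k => mul_nonneg (hb k) (by positivity)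
  simp only [Function.comp_apply]
  rw [← ENNReal.ofReal_sum_of_nonneg fun k _ => hnn k,
    exp_coe_ofReal (Finset.sum_nonneg fun k _ => hnn k)]

/-- Fatou's lemma along dyadic truncations, whose bounds are uniform by summability of `b_k/a_k`. -/
lemma IsFreeField.lintegral_expQuad_le (hμ : IsFreeField L m β μ) (hm : 0 < m) (hβ : 0 < β)
    (hb : ∀ k, 0 ≤ b k) (hb' : ∀ k, b k ≤ rate L m β k / 2)
    (hs : Summable fun k => b k / rate L m β k) :
    ∫⁻ φ, expQuad b φ ∂μ ≤ ENNReal.ofReal (Real.exp (2 * ∑' k, b k / rate L m β k)) := by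
  have hmeas : ∀ F : Finset ℤ, Measurable fun φ : Omega L =>
      ENNReal.ofReal (Real.exp (∑ k ∈ F, b k * ‖mode L k φ‖ ^ 2)) := fun F =>
    (Real.continuous_exp.comp (continuous_finsetSum _ fun k _ =>
      ((continuous_mode L k).norm.pow 2).const_mul _)).measurable.ennreal_ofReal
  calc ∫⁻ φ, expQuad b φ ∂μ
      = ∫⁻ φ, liminf (fun J => ENNReal.ofReal
          (Real.exp (∑ k ∈ dyadicBall J, b k * ‖mode L k φ‖ ^ 2))) atTop ∂μ := by
        simp_rw [(tendsto_expQuad hb _).liminf_eq]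
    _ ≤ liminf (fun J => ∫⁻ φ, ENNReal.ofReal
          (Real.exp (∑ k ∈ dyadicBall J, b k * ‖mode L k φ‖ ^ 2)) ∂μ) atTop :=
        lintegral_liminf_le fun J => hmeas _
    _ ≤ ENNReal.ofReal (Real.exp (2 * ∑' k, b k / rate L m β k)) := by
        refine liminf_le_of_frequently_le' (Frequently.of_forall fun J => ?_)
        refine (hμ.lintegral_exp_sum_le hm hβ hb hb' _).trans (ENNReal.ofReal_le_ofReal ?_)
        rw [← Finset.mul_sum]
        gcongr
        exact hs.sum_le_tsum _ fun k _ => div_nonneg (hb k) (rate_pos hm hβ k).le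

/-- Only the zero mode changes, and its new squared modulus is `s` minus the residual. Keeping the
old zero mode on the right is wasteful but lets that factor be integrated directly under `μ`. -/
lemma expQuad_surfacePoint_le (hb : ∀ k, 0 ≤ b k) {s : ℝ} {p : Omega L × ℝ}
    (hp : residual {0} p.1 ≤ s) :
    expQuad b (surfacePoint s p)
      ≤ ENNReal.ofReal (Real.exp (b 0 * (s - residual {0} p.1))) * expQuad b p.1 := by
  have hs : 0 ≤ s - residual {0} p.1 := sub_nonneg.2 hp
  have h1 : ∑' k : ℤ, ENNReal.ofReal (b k * ‖mode L k (surfacePoint s p)‖ ^ 2)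
      ≤ ENNReal.ofReal (b 0 * (s - residual {0} p.1))
        + ∑' k : ℤ, ENNReal.ofReal (b k * ‖mode L k p.1‖ ^ 2) := by
    rw [← tsum_ite_eq (0 : ℤ) (fun _ => ENNReal.ofReal (b 0 * (s - residual {0} p.1))),
      ← ENNReal.tsum_add]
    refine ENNReal.tsum_le_tsum fun k => ?_
    rw [surfacePoint, mode_resample]
    by_cases hk : k = 0
    · subst hk
      simp [norm_polarPoint_sq hs]
    · simp [hk]
  rw [expQuad, expQuad, ← exp_coe_ofReal (mul_nonneg (hb 0) hs), ← EReal.exp_add,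
    ← EReal.coe_ennreal_add]
  exact EReal.exp_monotone (EReal.coe_ennreal_le_coe_ennreal_iff.2 h1)

/-- With `t` the new squared modulus of the zero mode, the weight `e^(-a_0 t)` absorbs `e^(b_0 t)`
because `b_0 ≤ a_0/2`. Hence the bound does not depend on the level. -/
lemma IsFreeField.lintegral_expQuad_surfaceMeasure_le (hμ : IsFreeField L m β μ) (hm : 0 < m)
    (hβ : 0 < β) (hb : ∀ k, 0 ≤ b k) (hb' : ∀ k, b k ≤ rate L m β k / 2)
    (hs : Summable fun k => b k / rate L m β k) (s : ℝ) :
    ∫⁻ φ, expQuad b φ ∂(surfaceMeasure m β μ s)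
      ≤ ENNReal.ofReal (rate L m β 0 * Real.exp (2 * ∑' k, b k / rate L m β k)) := by
  have := hμ.isProbabilityMeasure
  have hpi := Real.pi_pos
  have hr := rate_pos (L := L) hm hβ 0
  rw [lintegral_surfaceMeasure s measurable_expQuad]
  calc ∫⁻ p, ENNReal.ofReal (surfaceWeight L m β s p) * expQuad b (surfacePoint s p)
        ∂(phaseMeasure μ)
      ≤ ∫⁻ p, expQuad b p.1 * ENNReal.ofReal (rate L m β 0 / (2 * Real.pi))
        ∂(phaseMeasure μ) := by
        refine lintegral_mono fun p => ?_
        rcases le_or_gt s (residual {0} p.1) with h | h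
        · simp [surfaceWeight_eq_zero h]
        · refine (mul_le_mul_right (expQuad_surfacePoint_le hb h.le) _).trans ?_
          rw [← mul_assoc, mul_comm, ← ENNReal.ofReal_mul (surfaceWeight_nonneg hm hβ s p)]
          gcongr
          rw [surfaceWeight, polarWeight, if_pos (sub_pos.2 h), mul_assoc, ← Real.exp_add]
          have h2 : Real.exp (-rate L m β 0 * (s - residual {0} p.1)
              + b 0 * (s - residual {0} p.1)) ≤ 1 := by
            rw [Real.exp_le_one_iff]
            nlinarith [hb' 0, sub_pos.2 h]
          exact mul_le_of_le_one_right (by positivity) h2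
    _ = (∫⁻ φ, expQuad b φ ∂μ) * ENNReal.ofReal (rate L m β 0) := by
        rw [phaseMeasure, lintegral_prod_mul measurable_expQuad.aemeasurable aemeasurable_const,
          lintegral_const, Measure.restrict_apply_univ, Real.volume_Ioo,
          ← ENNReal.ofReal_mul (by positivity)]
        congr 2
        field_simp
        ring
    _ ≤ _ := by
        rw [mul_comm, ENNReal.ofReal_mul hr.le]
        gcongr
        exact hμ.lintegral_expQuad_le hm hβ hb hb' hs

/-- Comparison with `|k|^(-2(1-γ))`, whose exponent is below `-1` precisely when `γ < 1/2`. -/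
lemma summable_eigen_rpow (hm : 0 < m) {γ : ℝ} (hγ : γ < 1 / 2) :
    Summable fun k : ℤ => eigen L m k ^ (γ - 1) := by
  have hL : 0 < L := Fact.out
  have hpi := Real.pi_pos
  have h1 : Summable fun k : ℤ => |(k : ℝ)| ^ (-(2 * (1 - γ))) :=
    Real.summable_abs_int_rpow (by linarith)
  refine Summable.of_norm_bounded_eventually
    (h1.mul_left (((2 * Real.pi / L) ^ 2) ^ (γ - 1))) ?_
  have h0 : ∀ᶠ k : ℤ in cofinite, k ≠ 0 := by
    simpa using (Set.finite_singleton (0 : ℤ)).compl_mem_cofinite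
  filter_upwards [h0] with k hk
  have hk' : 0 < |(k : ℝ)| := abs_pos.2 (by exact_mod_cast hk)
  rw [Real.norm_of_nonneg (Real.rpow_nonneg (eigen_pos hm k).le _)]
  have e : |(k : ℝ)| ^ (-(2 * (1 - γ))) = (|(k : ℝ)| ^ 2) ^ (γ - 1) := by
    rw [← Real.rpow_natCast, ← Real.rpow_mul hk'.le]
    congr 1
    push_cast
    ring
  rw [e, ← Real.mul_rpow (by positivity) (by positivity)]
  refine Real.rpow_le_rpow_of_nonpos (by positivity) ?_ (by linarith)
  rw [sq_abs, eigen]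
  have : (2 * Real.pi / L) ^ 2 * (k : ℝ) ^ 2 = (2 * Real.pi * k / L) ^ 2 := by ring
  rw [this]
  nlinarith [sq_nonneg m]

lemma ofReal_mul_sobolevSq (hm : 0 < m) {ε : ℝ} (hε : 0 ≤ ε) (γ : ℝ) (φ : Omega L) :
    ENNReal.ofReal ε * sobolevSq L m (γ / 2) φ
      = ∑' k : ℤ, ENNReal.ofReal (ε * eigen L m k ^ γ * ‖mode L k φ‖ ^ 2) := by
  rw [sobolevSq, ← ENNReal.tsum_mul_left]
  congr with k
  rw [← ENNReal.ofReal_mul hε, mul_pow, ← Real.rpow_natCast (eigen L m k ^ (γ / 2)),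
    ← Real.rpow_mul (eigen_pos hm k).le]
  congr 1
  push_cast
  rw [div_mul_cancel₀ _ (two_ne_zero)]
  ring

/-- Exponential integrability of Sobolev norms on the level sets of the mass, uniformly in the
level. -/
lemma IsFreeField.exists_lintegral_exp_sobolevSq_le (hμ : IsFreeField L m β μ) (hm : 0 < m)
    (hβ : 0 < β) {γ : ℝ} (hγ : γ < 1 / 2) :
    ∃ ε : ℝ, 0 < ε ∧ ∃ K : ℝ, ∀ s,
      ∫⁻ φ, EReal.exp ((ENNReal.ofReal ε * sobolevSq L m (γ / 2) φ : ℝ≥0∞) : EReal)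
        ∂(surfaceMeasure m β μ s) ≤ ENNReal.ofReal K := by
  -- Since `λ_k ≥ m²` and `γ < 1`, this gives `ε λ_k^γ ≤ (β/4) λ_k`, which is half the rate of mode
  -- `k`.
  set ε : ℝ := β / 4 * (m ^ 2) ^ (1 - γ) with hε
  have hε0 : 0 < ε := by positivity
  set b : ℤ → ℝ := fun k => ε * eigen L m k ^ γ with hbdef
  have hb : ∀ k, 0 ≤ b k := fun k => mul_nonneg hε0.le (Real.rpow_nonneg (eigen_pos hm k).le _)
  have hb' : ∀ k, b k ≤ rate L m β k / 2 := by
    intro k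
    have hk := eigen_pos (L := L) hm k
    have h1 : (m ^ 2) ^ (1 - γ) ≤ eigen L m k ^ (1 - γ) :=
      Real.rpow_le_rpow (by positivity) (sq_le_eigen k) (by linarith)
    calc b k ≤ β / 4 * eigen L m k ^ (1 - γ) * eigen L m k ^ γ := by
          simp only [hbdef, hε]
          gcongr
      _ = β / 4 * eigen L m k := by
          rw [mul_assoc, ← Real.rpow_add hk, sub_add_cancel, Real.rpow_one]
      _ = rate L m β k / 2 := by rw [rate]; ring
  have hs : Summable fun k => b k / rate L m β k := by
    refine ((summable_eigen_rpow (L := L) hm hγ).mul_left (2 * ε / β)).congr fun k => ?_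
    have hk := eigen_pos (L := L) hm k
    rw [Real.rpow_sub_one hk.ne']
    simp only [hbdef, rate]
    field_simp
  refine ⟨ε, hε0, rate L m β 0 * Real.exp (2 * ∑' k, b k / rate L m β k), fun s => ?_⟩
  simp_rw [ofReal_mul_sobolevSq hm hε0.le]
  exact hμ.lintegral_expQuad_surfaceMeasure_le hm hβ hb hb' hs s

end ExponentialMoments

/-! ### The normalized conditional laws. -/

section ConditionalLaw

variable {L : ℝ} [Fact (0 < L)] {m β : ℝ} {μ : Measure (Omega L)}

variable (m β μ) in
/-- The law of the free field conditioned on mass `n > 0`; an arbitrary point mass for `n ≤ 0`. -/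
noncomputable def conditionalLaw [IsFiniteMeasure μ] : Kernel ℝ (Omega L) where
  toFun n := if 0 < n then (surfaceMeasure m β μ n univ)⁻¹ • surfaceMeasure m β μ n
    else Measure.dirac 0
  measurable' := by
    refine Measurable.ite measurableSet_Ioi ?_ measurable_const
    refine Measure.measurable_of_measurable_coe _ fun A hA => ?_
    simp only [Measure.smul_apply, smul_eq_mul]
    have h := measurable_surfaceMeasure (m := m) (β := β) (μ := μ)
    exact ((Measure.measurable_coe MeasurableSet.univ).comp h).inv.mul
      ((Measure.measurable_coe hA).comp h)

lemma conditionalLaw_apply [IsFiniteMeasure μ] {n : ℝ} (hn : 0 < n) :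
    conditionalLaw m β μ n = (surfaceMeasure m β μ n univ)⁻¹ • surfaceMeasure m β μ n :=
  if_pos hn

lemma IsFreeField.surfaceMeasure_univ_ne_zero (hμ : IsFreeField L m β μ) (hm : 0 < m)
    (hβ : 0 < β) {n : ℝ} (hn : 0 < n) : surfaceMeasure m β μ n univ ≠ 0 := by
  have := hμ.isProbabilityMeasure
  rw [← ofReal_massDensity hm hβ]
  simpa using hμ.massDensity_pos hm hβ hn

lemma IsFreeField.isMarkovKernel_conditionalLaw [IsFiniteMeasure μ] (hμ : IsFreeField L m β μ)
    (hm : 0 < m) (hβ : 0 < β) : IsMarkovKernel (conditionalLaw m β μ) := by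
  have := hμ.isProbabilityMeasure
  refine ⟨fun n => ?_⟩
  by_cases hn : 0 < n
  · have := isFiniteMeasure_surfaceMeasure (μ := μ) hm hβ n
    rw [conditionalLaw_apply hn]
    constructor
    rw [Measure.smul_apply, smul_eq_mul]
    exact ENNReal.inv_mul_cancel (hμ.surfaceMeasure_univ_ne_zero hm hβ hn) (measure_ne_top _ _)
  · have : conditionalLaw m β μ n = Measure.dirac 0 := if_neg hn
    rw [this]
    infer_instance

lemma integral_conditionalLaw [IsFiniteMeasure μ] {n : ℝ} (hn : 0 < n) (f : Omega L → ℝ) :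
    ∫ φ, f φ ∂(conditionalLaw m β μ n)
      = (massDensity m β μ n)⁻¹ * ∫ φ, f φ ∂(surfaceMeasure m β μ n) := by
  rw [conditionalLaw_apply hn, integral_smul_measure, ENNReal.toReal_inv, smul_eq_mul]
  rfl

lemma IsFreeField.eq_lintegral_conditionalLaw [IsFiniteMeasure μ] (hμ : IsFreeField L m β μ)
    (hm : 0 < m) (hβ : 0 < β) {A : Set (Omega L)} (hA : MeasurableSet A) :
    μ A = ∫⁻ n in Ioi (0 : ℝ), ENNReal.ofReal (massDensity m β μ n) * conditionalLaw m β μ n A := by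
  have := hμ.isProbabilityMeasure
  rw [← lintegral_indicator_one hA, hμ.lintegral_eq hm hβ (measurable_one.indicator hA),
    ← lintegral_indicator measurableSet_Ioi]
  congr with n
  rw [lintegral_indicator_one hA]
  by_cases hn : 0 < n
  · have := isFiniteMeasure_surfaceMeasure (μ := μ) hm hβ n
    rw [indicator_of_mem (show n ∈ Ioi (0 : ℝ) from hn), conditionalLaw_apply hn,
      ofReal_massDensity hm hβ, Measure.smul_apply, smul_eq_mul, ← mul_assoc,
      ENNReal.mul_inv_cancel (hμ.surfaceMeasure_univ_ne_zero hm hβ hn) (measure_ne_top _ _),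
      one_mul]
  · rw [indicator_of_notMem (show n ∉ Ioi (0 : ℝ) from hn),
      surfaceMeasure_of_nonpos (not_lt.1 hn)]
    simp

end ConditionalLaw

end CircleField

theorem lemma3p3 (L m β : ℝ) [Fact (0 < L)] (hm : 0 < m) (hβ : 0 < β) :
    -- the Gaussian measure exists and is unique
    (∃! μ : Measure (CircleField.Omega L), CircleField.IsFreeField L m β μ) ∧
    ∀ μ : Measure (CircleField.Omega L), CircleField.IsFreeField L m β μ →
      -- the law of the mass has a smooth density, positive exactly on the positive half-line
      ∃ ρ : ℝ → ℝ, ContDiff ℝ ∞ ρ ∧ (∀ s, 0 < s → 0 < ρ s) ∧ (∀ s, s ≤ 0 → ρ s = 0) ∧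
        μ.map (CircleField.mass L) = volume.withDensity (fun s => ENNReal.ofReal (ρ s)) ∧
      -- the conditional laws, as a probability kernel (only its values at `n > 0` matter)
      ∃ ν : Kernel ℝ (CircleField.Omega L), IsMarkovKernel ν ∧
        -- they are the weak limits of the regularized laws
        (∀ n, 0 < n →
          (∀ ℓ : ℕ, 1 ≤ ℓ → IsProbabilityMeasure (CircleField.fejerLaw L μ n ℓ)) ∧
          ∀ f : CircleField.Omega L →ᵇ ℝ,
            Tendsto (fun ℓ : ℕ => ∫ φ, f φ ∂(CircleField.fejerLaw L μ n ℓ)) atTop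
              (𝓝 (∫ φ, f φ ∂(ν n)))) ∧
        -- they live on the level sets of the mass, and disintegrate `μ`
        (∀ n, 0 < n → ∀ᵐ φ ∂(ν n), CircleField.mass L φ = n) ∧
        (∀ A : Set (CircleField.Omega L), MeasurableSet A →
          μ A = ∫⁻ n in Ioi (0 : ℝ), ENNReal.ofReal (ρ n) * ν n A) ∧
        -- exponential integrability
        (∀ γ : ℝ, 0 ≤ γ → γ < 1 / 2 → ∃ ε : ℝ, 0 < ε ∧ ∃ K : ℝ, ∀ n, 0 < n →
          ∫⁻ φ, EReal.exp
              ((ENNReal.ofReal ε * CircleField.sobolevSq L m (γ / 2) φ : ℝ≥0∞) : EReal) ∂(ν n)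
            ≤ ENNReal.ofReal (K / ρ n)) := by
  refine ⟨?_, fun μ hμ => ?_⟩
  · obtain ⟨μ, hμ⟩ := CircleField.exists_isFreeField (L := L) hm hβ
    exact ⟨μ, hμ, fun P hP => hP.unique hμ⟩
  have := hμ.isProbabilityMeasure
  refine ⟨CircleField.massDensity m β μ, hμ.contDiff_massDensity hm hβ,
    fun s hs => hμ.massDensity_pos hm hβ hs, fun s hs => CircleField.massDensity_of_nonpos hs,
    hμ.map_mass hm hβ, CircleField.conditionalLaw m β μ, hμ.isMarkovKernel_conditionalLaw hm hβ,
    fun n hn => ⟨fun ℓ hℓ => hμ.isProbabilityMeasure_fejerLaw hm hβ hn hℓ, fun f => ?_⟩,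
    fun n hn => ?_, fun A hA => hμ.eq_lintegral_conditionalLaw hm hβ hA, fun γ _ hγ => ?_⟩
  · rw [CircleField.integral_conditionalLaw hn]
    exact hμ.tendsto_integral_fejerLaw hm hβ hn f
  · rw [CircleField.conditionalLaw_apply hn]
    exact Measure.ae_smul_measure (CircleField.ae_mass_surfaceMeasure n) _
  · obtain ⟨ε, hε, K, h⟩ := hμ.exists_lintegral_exp_sobolevSq_le hm hβ hγ
    refine ⟨ε, hε, K, fun n hn => ?_⟩
    have hρ := hμ.massDensity_pos hm hβ hn
    -- The factor `1/ρ(n)` is exactly the normalization of the surface measure; `K` is the uniform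
    -- bound before normalization.
    rw [CircleField.conditionalLaw_apply hn, lintegral_smul_measure,
      ← CircleField.ofReal_massDensity hm hβ, div_eq_inv_mul K,
      ENNReal.ofReal_mul (inv_nonneg.2 hρ.le), ENNReal.ofReal_inv_of_pos hρ, smul_eq_mul]
    gcongr
    exact h n
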